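/- Let $c\ge 1$ and $r=c$. For a matrix $M\in\mathbb R^{c\times r}$ and positive definite matrices $\Sigma_c\in\mathbb R^{c\times c}$, $\Sigma_r\in\mathbb R^{r\times r}$, let $X_1,\dots,X_N$ be independent random $c\times r$ matrices from the matrix-variate normal distribution $\mathcal N_{c,r}(M,\Sigma_c,\Sigma_r)$, that is, $\mathrm{vec}(X_n)\sim\mathcal N_{cr}(\mu,\Sigma)$ with $\mu=\mathrm{vec}(M)$ (columns stacked) and the Kronecker-structured covariance $\Sigma=\Sigma_r\otimes\Sigma_c$. Define the vector-based and the matrix-based Mahalanobis squared distances $$\Delta(x,\mu,\Sigma)=(x-\mu)^\top\Sigma^{-1}(x-\mu),\qquad \Delta_M(X,M,\Sigma_c,\Sigma_r)=\mathrm{tr}\{\Sigma_c^{-1}(X-M)\Sigma_r^{-1}(X-M)^\top\},$$ the sample mean and sample covariance $$\hat M=\frac1N\sum_{n=1}^N X_n,\qquad \hat\mu=\mathrm{vec}(\hat M),\qquad \hat\Sigma=\frac1{N-1}\sum_{n=1}^N(\mathrm{vec}(X_n)-\hat\mu)(\mathrm{vec}(X_n)-\hat\mu)^\top,$$ and call a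 pair $(\hat\Sigma_c,\hat\Sigma_r)$ of positive definite matrices flip-flop maximum likelihood estimates if $$\hat\Sigma_c=\frac1{Nr}\sum_{n=1}^N(X_n-\hat M)\hat\Sigma_r^{-1}(X_n-\hat M)^\top,\qquad \hat\Sigma_r=\frac1{Nc}\sum_{n=1}^N(X_n-\hat M)^\top\hat\Sigma_c^{-1}(X_n-\hat M).$$ Then, as $N\to\infty$, $$\Delta(\mathrm{vec}(X_n),\hat\mu,\hat\Sigma)=\Delta(\mathrm{vec}(X_n),\mu,\Sigma)+O_p\!\left(\frac{c^2}{\sqrt N}\right),\qquad \Delta_M(X_n,\hat M,\hat\Sigma_c,\hat\Sigma_r)=\Delta_M(X_n,M,\Sigma_c,\Sigma_r)+O_p\!\left(\frac{c}{\sqrt N}\right),$$ with constants that do not depend on $c$. Precisely: for every $\varepsilon>0$ there is $K>0$ such that for every $c\ge1$ there is $N_0$ such that for all $N\ge N_0$, all $M,\Sigma_c,\Sigma_r$, every such sample and every $n\in\{1,\dots,N\}$: 1. with probability at least $1-\varepsilon$, $\hat\Sigma$ is positive definite and $|\Delta(\mathrm{vec}(X_n),\hat\mu,\hat\Sigma)-\Delta(\mathrm{vec}(X_n),\mu,\Sigma)|\le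 K c^2/\sqrt N$; 2. with probability at least $1-\varepsilon$, flip-flop maximum likelihood estimates exist, and every pair $(\hat\Sigma_c,\hat\Sigma_r)$ of them satisfies $|\Delta_M(X_n,\hat M,\hat\Sigma_c,\hat\Sigma_r)-\Delta_M(X_n,M,\Sigma_c,\Sigma_r)|\le K c/\sqrt N$. (The probability of failure is understood as an outer probability where measurability is not known.) -/

import Mathlib

open MeasureTheory ProbabilityTheory
open scoped Matrix Kronecker

noncomputable section

namespace MatrixNormal

/-- Vector-based Mahalanobis squared distance `(x - μ)ᵀ S⁻¹ (x - μ)`. -/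
def vecMSD {ι : Type*} [Fintype ι] [DecidableEq ι]
    (x μ : ι → ℝ) (S : Matrix ι ι ℝ) : ℝ :=
  (x - μ) ⬝ᵥ (S⁻¹ *ᵥ (x - μ))

/-- Matrix-based Mahalanobis squared distance `tr (Sc⁻¹ (X - M) Sr⁻¹ (X - M)ᵀ)`. -/
def matMSD {c r : ℕ} (X M : Matrix (Fin c) (Fin r) ℝ)
    (Sc : Matrix (Fin c) (Fin c) ℝ) (Sr : Matrix (Fin r) (Fin r) ℝ) : ℝ :=
  (Sc⁻¹ * (X - M) * Sr⁻¹ * (X - M)ᵀ).trace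

/-- Sample mean of vectors. -/
def vecMean {ι : Type*} {N : ℕ} (x : Fin N → ι → ℝ) : ι → ℝ :=
  (N : ℝ)⁻¹ • ∑ n, x n

/-- Sample covariance matrix, with the normalization `1 / (N - 1)`. -/
def vecCov {ι : Type*} {N : ℕ} (x : Fin N → ι → ℝ) : Matrix ι ι ℝ :=
  ((N : ℝ) - 1)⁻¹ • ∑ n, Matrix.vecMulVec (x n - vecMean x) (x n - vecMean x)

/-- Sample mean of matrices. -/
def matMean {c r N : ℕ} (X : Fin N → Matrix (Fin c) (Fin r) ℝ) : Matrix (Fin c) (Fin r) ℝ :=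
  (N : ℝ)⁻¹ • ∑ n, X n

/-- One flip-flop update of the column covariance from the row covariance `Sr`. -/
def flipC {c r N : ℕ} (X : Fin N → Matrix (Fin c) (Fin r) ℝ)
    (Sr : Matrix (Fin r) (Fin r) ℝ) : Matrix (Fin c) (Fin c) ℝ :=
  ((N : ℝ) * r)⁻¹ • ∑ n, (X n - matMean X) * Sr⁻¹ * (X n - matMean X)ᵀ

/-- One flip-flop update of the row covariance from the column covariance `Sc`. -/
def flipR {c r N : ℕ} (X : Fin N → Matrix (Fin c) (Fin r) ℝ)
    (Sc : Matrix (Fin c) (Fin c) ℝ) : Matrix (Fin r) (Fin r) ℝ :=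
  ((N : ℝ) * c)⁻¹ • ∑ n, (X n - matMean X)ᵀ * Sc⁻¹ * (X n - matMean X)

/-- `(Sc, Sr)` is a flip-flop maximum likelihood estimate for the data `X`: a pair of positive
definite matrices that solves the two coupled likelihood equations, that is, at which the
alternating updates have converged. (The positive definite limits of the alternating scheme are
exactly these pairs.) Such a pair is determined only up to `(a • Sc, a⁻¹ • Sr)`, a change that
leaves `matMSD` as it is. -/
structure IsFlipFlopMLE {c r N : ℕ} (X : Fin N → Matrix (Fin c) (Fin r) ℝ)
    (Sc : Matrix (Fin c) (Fin c) ℝ) (Sr : Matrix (Fin r) (Fin r) ℝ) : Prop where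
  posDef_c : Sc.PosDef
  posDef_r : Sr.PosDef
  eq_c : Sc = flipC X Sr
  eq_r : Sr = flipR X Sc

/-- `X 0, …, X (N - 1)` is an independent sample from the matrix-variate normal distribution with
mean `M`, column covariance `Sc` and row covariance `Sr`: the vectorizations (columns stacked) are
independent with law `𝒩(vec M, Sr ⊗ Sc)`. -/
structure IsSample {Ω : Type*} [MeasurableSpace Ω] (P : Measure Ω) {c r N : ℕ}
    (X : Fin N → Ω → Matrix (Fin c) (Fin r) ℝ) (M : Matrix (Fin c) (Fin r) ℝ)
    (Sc : Matrix (Fin c) (Fin c) ℝ) (Sr : Matrix (Fin r) (Fin r) ℝ) : Prop where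
  hasLaw : ∀ n, HasLaw (fun ω => WithLp.toLp 2 (X n ω).vec)
    (multivariateGaussian (WithLp.toLp 2 M.vec) (Sr ⊗ₖ Sc)) P
  indep : iIndepFun (fun n ω => (WithLp.toLp 2 (X n ω).vec :
    EuclideanSpace ℝ (Fin r × Fin c))) P

end MatrixNormal

end

/-
Both distances are affine equivariant, so whitening reduces everything to independent standard
Gaussian vectors `z k`. Write their empirical covariance as `1 + D`, with `D` of order `1 / √N`. The
flip-flop equations are solved to first order in `D`, and the linear part of the distance error at
the observation `n` is `-N⁻¹ ∑ k, h (z n) (z k)` for a kernel `h` that is degenerate in its second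
argument. The terms `k ≠ n` of this sum are pairwise uncorrelated, with second moments
`O((c + r) ^ 2)`, so that Chebyshev's inequality gives the rate `(c + r) / √N`. Everything else is
`O_p(1 / N)` in fixed dimensions and is absorbed by taking `N` large.

Flip-flop estimates exist because `det q ^ c / det (contract S q) ^ r`, the profile likelihood of
the row precision `q`, attains its maximum on the compact set of positive semidefinite matrices of
trace one, and a maximizer solves the equations. The vector-based distance is the matrix-based one
for matrices with a single column of length `c * r`, which turns the rate `c + r` into `c * r`.
-/

noncomputable section

namespace MatrixNormal

open scoped RealInnerProductSpace NNReal ENNReal Matrix.Norms.Frobenius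

section GaussianMoments

lemma integrable_pow_gaussianReal (v : ℝ≥0) (k : ℕ) :
    Integrable (fun x ↦ x ^ k) (gaussianReal 0 v) :=
  (memLp_id_gaussianReal' (k : ℝ≥0∞) (by simp)).integrable_norm_pow'.mono
    (by fun_prop) (by simp)

lemma integral_sq_gaussianReal (v : ℝ≥0) : ∫ x, x ^ 2 ∂(gaussianReal 0 v) = v := by
  have h := variance_fun_id_gaussianReal (μ := 0) (v := v)
  rw [variance_eq_integral (by fun_prop), integral_id_gaussianReal] at h
  simpa using h

-- The sum of two independent copies has the law of `√2` times one of them.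
lemma integral_pow_four_gaussianReal (v : ℝ≥0) :
    ∫ x, x ^ 4 ∂(gaussianReal 0 v) = 3 * (v : ℝ) ^ 2 := by
  set μ := gaussianReal 0 v with hμ
  have hscale : ∫ x, x ^ 4 ∂(gaussianReal 0 (v + v)) = 4 * ∫ x, x ^ 4 ∂μ := by
    have h := gaussianReal_map_const_mul (μ := 0) (v := v) √2
    rw [mul_zero, show (NNReal.mk (√2 ^ 2) (sq_nonneg _)) * v = v + v by ext; simp [two_mul]] at h
    rw [← h, integral_map (by fun_prop) (by fun_prop), ← integral_const_mul]
    refine integral_congr_ae (.of_forall fun x ↦ ?_)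
    simp only [mul_pow, show √2 ^ 4 = 4 by rw [show √2 ^ 4 = (√2 ^ 2) ^ 2 by ring]; norm_num]
  have hsum : ∫ x, x ^ 4 ∂(gaussianReal 0 (v + v)) = 2 * ∫ x, x ^ 4 ∂μ + 6 * (v : ℝ) ^ 2 := by
    have hint : ∀ k l, Integrable (fun z : ℝ × ℝ ↦ z.1 ^ k * z.2 ^ l) (μ.prod μ) := fun k l ↦
      (integrable_pow_gaussianReal v k).mul_prod (integrable_pow_gaussianReal v l)
    have hval : ∀ k l, ∫ z : ℝ × ℝ, z.1 ^ k * z.2 ^ l ∂(μ.prod μ)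
        = (∫ x, x ^ k ∂μ) * ∫ x, x ^ l ∂μ := fun k l ↦ integral_prod_mul _ _
    have hconv := gaussianReal_conv_gaussianReal (m₁ := 0) (m₂ := 0) (v₁ := v) (v₂ := v)
    rw [add_zero, Measure.conv, ← hμ] at hconv
    rw [← hconv, integral_map (by fun_prop) (by fun_prop)]
    simp_rw [add_pow]
    rw [integral_finsetSum _ fun k _ ↦ (hint k (4 - k)).mul_const _]
    simp only [integral_mul_const, hval]
    simp [Finset.sum_range_succ, Nat.choose, hμ, integral_sq_gaussianReal]
    ring
  linarith

variable {E : Type*} [NormedAddCommGroup E] [InnerProductSpace ℝ E] [FiniteDimensional ℝ E]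
  [MeasurableSpace E] [BorelSpace E]

lemma hasLaw_inner_stdGaussian (u : E) :
    HasLaw (fun x ↦ ⟪u, x⟫) (gaussianReal 0 (‖u‖₊ ^ 2)) (stdGaussian E) := by
  refine ⟨by fun_prop, ?_⟩
  change (stdGaussian E).map (innerSL ℝ u) = _
  rw [IsGaussian.map_eq_gaussianReal, integral_strongDual_stdGaussian, variance_dual_stdGaussian]
  congr 1
  ext
  simp [innerSL_apply_norm]

lemma memLp_inner_stdGaussian (u : E) {p : ℝ≥0∞} (hp : p ≠ ∞) :
    MemLp (fun x ↦ ⟪u, x⟫) p (stdGaussian E) := by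
  have h := hasLaw_inner_stdGaussian u
  have hid := memLp_id_gaussianReal' (μ := 0) (v := ‖u‖₊ ^ 2) p hp
  rwa [← h.map_eq, memLp_map_measure_iff (by fun_prop) h.aemeasurable] at hid

lemma integral_inner_sq (u : E) : ∫ x, ⟪u, x⟫ ^ 2 ∂(stdGaussian E) = ⟪u, u⟫ := by
  have h := (hasLaw_inner_stdGaussian u).integral_comp (f := (· ^ 2)) (by fun_prop)
  simpa [integral_sq_gaussianReal, Function.comp_def] using h

lemma integral_inner_pow_four (u : E) :
    ∫ x, ⟪u, x⟫ ^ 4 ∂(stdGaussian E) = 3 * ⟪u, u⟫ ^ 2 := by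
  have h := (hasLaw_inner_stdGaussian u).integral_comp (f := (· ^ 4)) (by fun_prop)
  simpa [integral_pow_four_gaussianReal, Function.comp_def] using h

lemma integral_inner_mul_inner (a b : E) :
    ∫ x, ⟪a, x⟫ * ⟪b, x⟫ ∂(stdGaussian E) = ⟪a, b⟫ := by
  have hi : ∀ u, Integrable (fun x ↦ ⟪u, x⟫ ^ 2) (stdGaussian E) := fun u ↦
    (memLp_inner_stdGaussian u (by simp)).integrable_sq
  have hpol : (fun x : E ↦ ⟪a, x⟫ * ⟪b, x⟫)
      = fun x ↦ (1 / 4) * (⟪a + b, x⟫ ^ 2 - ⟪a - b, x⟫ ^ 2) := by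
    ext x
    simp only [inner_add_left, inner_sub_left]
    ring
  rw [hpol, integral_const_mul, integral_sub (hi _) (hi _), integral_inner_sq, integral_inner_sq]
  simp only [inner_add_left, inner_sub_left, inner_add_right, inner_sub_right, real_inner_comm a b]
  ring

-- Isserlis' formula, by polarization.
lemma integral_inner_mul_four (a b c d : E) :
    ∫ x, (⟪a, x⟫ * ⟪b, x⟫) * (⟪c, x⟫ * ⟪d, x⟫) ∂(stdGaussian E)
      = ⟪a, b⟫ * ⟪c, d⟫ + ⟪a, c⟫ * ⟪b, d⟫ + ⟪a, d⟫ * ⟪b, c⟫ := by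
  have hi : ∀ u, Integrable (fun x ↦ ⟪u, x⟫ ^ 4) (stdGaussian E) := fun u ↦ by
    have := (memLp_inner_stdGaussian u (p := 4) (by simp)).integrable_norm_pow (by simp)
    simpa [Even.pow_abs (by decide : Even 4)] using this
  have hs : ∀ u v, Integrable (fun x ↦ ⟪u, x⟫ ^ 4 - ⟪v, x⟫ ^ 4) (stdGaussian E) :=
    fun u v ↦ (hi u).sub (hi v)
  have hss : ∀ u v u' v', Integrable (fun x ↦ (⟪u, x⟫ ^ 4 - ⟪v, x⟫ ^ 4)
      - (⟪u', x⟫ ^ 4 - ⟪v', x⟫ ^ 4)) (stdGaussian E) := fun u v u' v' ↦ (hs u v).sub (hs u' v')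
  have hpol : (fun x : E ↦ (⟪a, x⟫ * ⟪b, x⟫) * (⟪c, x⟫ * ⟪d, x⟫))
      = fun x ↦ (1 / 192) * (((⟪a + b + c + d, x⟫ ^ 4 - ⟪a + b + c - d, x⟫ ^ 4)
        - (⟪a + b - c + d, x⟫ ^ 4 - ⟪a + b - c - d, x⟫ ^ 4))
        - ((⟪a - b + c + d, x⟫ ^ 4 - ⟪a - b + c - d, x⟫ ^ 4)
        - (⟪a - b - c + d, x⟫ ^ 4 - ⟪a - b - c - d, x⟫ ^ 4))) := by
    ext x
    simp only [inner_add_left, inner_sub_left]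
    ring
  rw [hpol, integral_const_mul, integral_sub (hss _ _ _ _) (hss _ _ _ _),
    integral_sub (hs _ _) (hs _ _), integral_sub (hs _ _) (hs _ _)]
  simp only [integral_sub (hi _) (hi _), integral_inner_pow_four]
  simp only [inner_add_left, inner_sub_left, inner_add_right, inner_sub_right,
    real_inner_comm a b, real_inner_comm a c, real_inner_comm a d, real_inner_comm b c,
    real_inner_comm b d, real_inner_comm c d]
  ring

end GaussianMoments

section IndependentSums

variable {Ω : Type*} [MeasurableSpace Ω] {P : Measure Ω}

lemma measure_lt_le_ofReal_integral_div {f : Ω → ℝ} (hf : Integrable f P) (hf0 : 0 ≤ f)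
    {t : ℝ} (ht : 0 < t) :
    P {ω | t < f ω} ≤ ENNReal.ofReal ((∫ ω, f ω ∂P) / t) := by
  have h := meas_ge_le_lintegral_div (μ := P) hf.aemeasurable.ennreal_ofReal
    (ε := ENNReal.ofReal t) (by simpa using ht) ENNReal.ofReal_ne_top
  rw [← ofReal_integral_eq_lintegral_ofReal hf (.of_forall hf0),
    ← ENNReal.ofReal_div_of_pos ht] at h
  exact (measure_mono fun ω hω ↦ ENNReal.ofReal_le_ofReal (le_of_lt hω)).trans h

variable {E : Type*} [MeasurableSpace E] {γ : Measure E} {κ : Type*} {z : κ → Ω → E}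

lemma memLp_comp_of_hasLaw {g : Ω → E} (hg : HasLaw g γ P) {f : E → ℝ} {p : ℝ≥0∞}
    (hf : MemLp f p γ) : MemLp (fun ω ↦ f (g ω)) p P := by
  rw [← hg.map_eq] at hf
  exact hf.comp_of_map hg.aemeasurable

variable [IsProbabilityMeasure P]

lemma integral_sq_sum_of_iIndepFun (hz : ∀ k, HasLaw (z k) γ P) (hind : iIndepFun z P)
    {φ : E → ℝ} (hφm : Measurable φ) (hφ : MemLp φ 2 γ) (hφ0 : ∫ x, φ x ∂γ = 0) (s : Finset κ) :
    ∫ ω, (∑ k ∈ s, φ (z k ω)) ^ 2 ∂P = s.card * ∫ x, φ x ^ 2 ∂γ := by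
  have hL : ∀ k, MemLp (fun ω ↦ φ (z k ω)) 2 P := fun k ↦ memLp_comp_of_hasLaw (hz k) hφ
  have hzero : ∀ k, ∫ ω, φ (z k ω) ∂P = 0 := fun k ↦
    ((hz k).integral_comp hφ.aestronglyMeasurable).trans hφ0
  have hsq : ∀ k, ∫ ω, φ (z k ω) ^ 2 ∂P = ∫ x, φ x ^ 2 ∂γ := fun k ↦
    (hz k).integral_comp (f := fun x ↦ φ x ^ 2) (by fun_prop)
  have hsum : ∫ ω, (∑ k ∈ s, fun ω ↦ φ (z k ω)) ω ∂P = 0 := by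
    simp only [Finset.sum_apply]
    rw [integral_finsetSum _ fun k _ ↦ (hL k).integrable (by norm_num)]
    simp [hzero]
  have hvar := IndepFun.variance_sum (fun k _ ↦ hL k) (s := s)
    fun k _ l _ hkl ↦ (hind.indepFun hkl).comp hφm hφm
  rw [variance_of_integral_eq_zero (memLp_finsetSum' s fun k _ ↦ hL k).aemeasurable hsum] at hvar
  simpa [variance_of_integral_eq_zero (hL _).aemeasurable (hzero _), hsq] using hvar

variable {h : E → E → ℝ} {s : Finset κ} {n : κ}

lemma memLp_kernel (hz : ∀ k, HasLaw (z k) γ P) (hind : iIndepFun z P)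
    (hL : MemLp (fun p : E × E ↦ h p.1 p.2) 2 (γ.prod γ)) {k : κ} (hk : n ≠ k) :
    MemLp (fun ω ↦ h (z n ω) (z k ω)) 2 P :=
  memLp_comp_of_hasLaw ((hind.indepFun hk).hasLaw_prod (hz n) (hz k)) hL

lemma integral_kernel_mul_kernel_of_ne (hz : ∀ k, HasLaw (z k) γ P) (hind : iIndepFun z P)
    (hm : Measurable fun p : E × E ↦ h p.1 p.2)
    (hL : MemLp (fun p : E × E ↦ h p.1 p.2) 2 (γ.prod γ)) (hdeg : ∀ x, ∫ y, h x y ∂γ = 0)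
    {k l : κ} (hk : n ≠ k) (hl : n ≠ l) (hkl : k ≠ l) :
    ∫ ω, h (z n ω) (z k ω) * h (z n ω) (z l ω) ∂P = 0 := by
  have : IsProbabilityMeasure γ := (hz n).isProbabilityMeasure_iff.1 inferInstance
  have hlaw : HasLaw (fun ω ↦ ((z n ω, z k ω), z l ω)) ((γ.prod γ).prod γ) P :=
    (hind.indepFun_prodMk₀ (fun j ↦ (hz j).aemeasurable) n k l hl hkl).hasLaw_prod
      ((hind.indepFun hk).hasLaw_prod (hz n) (hz k)) (hz l)
  let F : (E × E) × E → ℝ := fun t ↦ h t.1.1 t.1.2 * h t.1.1 t.2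
  have hF : Measurable F :=
    (hm.comp measurable_fst).mul (hm.comp (measurable_fst.fst.prodMk measurable_snd))
  have hint : Integrable F ((γ.prod γ).prod γ) := by
    rw [← hlaw.map_eq, integrable_map_measure hF.aestronglyMeasurable hlaw.aemeasurable]
    exact (memLp_kernel hz hind hL hk).integrable_mul (memLp_kernel hz hind hL hl)
  refine (hlaw.integral_comp hF.aestronglyMeasurable).trans ?_
  rw [integral_prod F hint]
  simp [F, integral_const_mul, hdeg]

lemma memLp_sum_kernel (hz : ∀ k, HasLaw (z k) γ P) (hind : iIndepFun z P)
    (hL : MemLp (fun p : E × E ↦ h p.1 p.2) 2 (γ.prod γ)) (hn : n ∉ s) :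
    MemLp (fun ω ↦ ∑ k ∈ s, h (z n ω) (z k ω)) 2 P :=
  memLp_finsetSum s fun _ hk ↦ memLp_kernel hz hind hL (ne_of_mem_of_not_mem hk hn).symm

lemma integral_sq_sum_kernel (hz : ∀ k, HasLaw (z k) γ P) (hind : iIndepFun z P)
    (hm : Measurable fun p : E × E ↦ h p.1 p.2)
    (hL : MemLp (fun p : E × E ↦ h p.1 p.2) 2 (γ.prod γ)) (hdeg : ∀ x, ∫ y, h x y ∂γ = 0)
    (hn : n ∉ s) :
    ∫ ω, (∑ k ∈ s, h (z n ω) (z k ω)) ^ 2 ∂P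
      = s.card * ∫ p : E × E, h p.1 p.2 ^ 2 ∂(γ.prod γ) := by
  have hne : ∀ k ∈ s, n ≠ k := fun _ hk ↦ (ne_of_mem_of_not_mem hk hn).symm
  have hint : ∀ k ∈ s, ∀ l ∈ s, Integrable (fun ω ↦ h (z n ω) (z k ω) * h (z n ω) (z l ω)) P :=
    fun k hk l hl ↦ (memLp_kernel hz hind hL (hne k hk)).integrable_mul
      (memLp_kernel hz hind hL (hne l hl))
  have hdiag : ∀ k ∈ s, ∫ ω, h (z n ω) (z k ω) * h (z n ω) (z k ω) ∂P
      = ∫ p : E × E, h p.1 p.2 ^ 2 ∂(γ.prod γ) := fun k hk ↦ by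
    simp_rw [← sq]
    exact ((hind.indepFun (hne k hk)).hasLaw_prod (hz n) (hz k)).integral_comp
      (f := fun p : E × E ↦ h p.1 p.2 ^ 2) (hL.aestronglyMeasurable.pow 2)
  simp_rw [sq (∑ _ ∈ s, _), Finset.sum_mul_sum]
  rw [integral_finsetSum _ fun k hk ↦ integrable_finsetSum _ fun l hl ↦ hint k hk l hl,
    ← nsmul_eq_mul, ← Finset.sum_const]
  refine Finset.sum_congr rfl fun k hk ↦ ?_
  rw [integral_finsetSum _ fun l hl ↦ hint k hk l hl,
    Finset.sum_eq_single_of_mem k hk fun l hl hlk ↦ integral_kernel_mul_kernel_of_ne hz hind hm hL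
      hdeg (hne k hk) (hne l hl) hlk.symm, hdiag k hk]

end IndependentSums

section StandardCoordinates

variable {ι κ : Type*}

/-- The fluctuation `x xᵀ - 1` of the outer square of a standard Gaussian vector about its mean. -/
def centeredOuter [DecidableEq ι] (x : EuclideanSpace ℝ ι) : Matrix ι ι ℝ :=
  Matrix.vecMulVec x x - 1

lemma centeredOuter_apply [DecidableEq ι] (x : EuclideanSpace ℝ ι) (i j : ι) :
    centeredOuter x i j = x i * x j - (1 : Matrix ι ι ℝ) i j := rfl

@[fun_prop]
lemma measurable_centeredOuter_apply [DecidableEq ι] (i j : ι) :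
    Measurable fun x : EuclideanSpace ℝ ι ↦ centeredOuter x i j := by
  simp only [centeredOuter_apply]
  fun_prop

variable [Fintype ι] [Fintype κ]

lemma frobenius_norm_sq (A : Matrix ι κ ℝ) :
    ‖A‖ ^ 2 = ∑ i, ∑ j, A i j ^ 2 := by
  rw [Matrix.frobenius_norm_def, ← Real.sqrt_eq_rpow, Real.sq_sqrt (by positivity)]
  simp

lemma trace_mul_eq_sum (A : Matrix ι κ ℝ) (B : Matrix κ ι ℝ) :
    (A * B).trace = ∑ a : ι × κ, B a.2 a.1 * A a.1 a.2 := by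
  simp [Matrix.trace, Matrix.mul_apply, Fintype.sum_prod_type, mul_comm]

lemma integral_sum_sum {α : Type*} [MeasurableSpace α] {μ : Measure α} {f : ι → κ → α → ℝ}
    (hf : ∀ i j, Integrable (f i j) μ) :
    ∫ x, ∑ i, ∑ j, f i j x ∂μ = ∑ i, ∑ j, ∫ x, f i j x ∂μ := by
  rw [integral_finsetSum _ fun i _ ↦ integrable_finsetSum _ fun j _ ↦ hf i j]
  exact Finset.sum_congr rfl fun i _ ↦ integral_finsetSum _ fun j _ ↦ hf i j

local notation "γ" => stdGaussian (EuclideanSpace ℝ ι)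

lemma memLp_apply (i : ι) : MemLp (fun x : EuclideanSpace ℝ ι ↦ x i) 2 γ := by
  classical
  simpa [EuclideanSpace.inner_single_left] using
    memLp_inner_stdGaussian (EuclideanSpace.single i (1 : ℝ)) (p := 2) (by simp)

lemma memLp_apply_mul_apply (i j : ι) : MemLp (fun x : EuclideanSpace ℝ ι ↦ x i * x j) 2 γ := by
  classical
  have h : ∀ i : ι, MemLp (fun x : EuclideanSpace ℝ ι ↦ x i) 4 γ := fun i ↦ by
    simpa [EuclideanSpace.inner_single_left] using
      memLp_inner_stdGaussian (EuclideanSpace.single i (1 : ℝ)) (p := 4) (by simp)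
  have : ENNReal.HolderTriple 4 4 2 := ⟨by
    rw [← ENNReal.toReal_eq_toReal_iff' (by simp) (by simp), ENNReal.toReal_add (by simp) (by simp)]
    norm_num⟩
  exact (h j).mul (h i)

lemma integrable_apply_mul_four (i j k l : ι) :
    Integrable (fun x : EuclideanSpace ℝ ι ↦ (x i * x j) * (x k * x l)) γ :=
  (memLp_apply_mul_apply i j).integrable_mul (memLp_apply_mul_apply k l)

variable [DecidableEq ι]

lemma integral_apply_mul_apply (i j : ι) :
    ∫ x : EuclideanSpace ℝ ι, x i * x j ∂γ = (1 : Matrix ι ι ℝ) i j := by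
  simpa [EuclideanSpace.inner_single_left, Matrix.one_apply, Pi.single_apply] using
    integral_inner_mul_inner (EuclideanSpace.single i (1 : ℝ)) (EuclideanSpace.single j 1)

lemma integral_apply_mul_four (i j k l : ι) :
    ∫ x : EuclideanSpace ℝ ι, (x i * x j) * (x k * x l) ∂γ
      = (1 : Matrix ι ι ℝ) i j * (1 : Matrix ι ι ℝ) k l
        + (1 : Matrix ι ι ℝ) i k * (1 : Matrix ι ι ℝ) j l
        + (1 : Matrix ι ι ℝ) i l * (1 : Matrix ι ι ℝ) j k := by
  simpa [EuclideanSpace.inner_single_left, Matrix.one_apply, Pi.single_apply] using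
    integral_inner_mul_four (EuclideanSpace.single i (1 : ℝ)) (EuclideanSpace.single j 1)
      (EuclideanSpace.single k 1) (EuclideanSpace.single l 1)

lemma memLp_centeredOuter_apply (i j : ι) : MemLp (fun x ↦ centeredOuter x i j) 2 γ :=
  (memLp_apply_mul_apply i j).sub (memLp_const _)

lemma integral_centeredOuter_apply (i j : ι) : ∫ x, centeredOuter x i j ∂γ = 0 := by
  simp only [centeredOuter_apply]
  rw [integral_sub ((memLp_apply_mul_apply i j).integrable (by norm_num)) (integrable_const _),
    integral_apply_mul_apply]
  simp

lemma integral_centeredOuter_mul (i j k l : ι) :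
    ∫ x, centeredOuter x i j * centeredOuter x k l ∂γ
      = (1 : Matrix ι ι ℝ) i k * (1 : Matrix ι ι ℝ) j l
        + (1 : Matrix ι ι ℝ) i l * (1 : Matrix ι ι ℝ) j k := by
  have hi : ∀ i j : ι, Integrable (fun x : EuclideanSpace ℝ ι ↦ x i * x j) γ :=
    fun i j ↦ (memLp_apply_mul_apply i j).integrable (by norm_num)
  have hexpand : (fun x : EuclideanSpace ℝ ι ↦ centeredOuter x i j * centeredOuter x k l)
      = fun x ↦ (x i * x j) * (x k * x l) - (1 : Matrix ι ι ℝ) k l * (x i * x j)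
        - (1 : Matrix ι ι ℝ) i j * centeredOuter x k l := by
    ext x
    simp only [centeredOuter_apply]
    ring
  have hfirst : Integrable (fun x : EuclideanSpace ℝ ι ↦
      (x i * x j) * (x k * x l) - (1 : Matrix ι ι ℝ) k l * (x i * x j)) γ :=
    (integrable_apply_mul_four i j k l).sub ((hi i j).const_mul _)
  rw [hexpand, integral_sub hfirst
    (((memLp_centeredOuter_apply k l).integrable (by norm_num)).const_mul _),
    integral_sub (integrable_apply_mul_four i j k l) ((hi i j).const_mul _), integral_const_mul,
    integral_const_mul, integral_apply_mul_four, integral_apply_mul_apply,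
    integral_centeredOuter_apply]
  ring

lemma memLp_trace_centeredOuter_mul (Q : Matrix ι ι ℝ) :
    MemLp (fun x ↦ (centeredOuter x * Q).trace) 2 γ := by
  simp only [trace_mul_eq_sum]
  exact memLp_finsetSum _ fun a _ ↦ (memLp_centeredOuter_apply _ _).const_mul _

lemma integral_trace_centeredOuter_mul (Q : Matrix ι ι ℝ) :
    ∫ x, (centeredOuter x * Q).trace ∂γ = 0 := by
  simp only [trace_mul_eq_sum]
  rw [integral_finsetSum _ fun a _ ↦
    ((memLp_centeredOuter_apply _ _).integrable (by norm_num)).const_mul _]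
  simp [integral_const_mul, integral_centeredOuter_apply]

lemma integral_sq_trace_centeredOuter_mul {Q : Matrix ι ι ℝ} (hQ : Q.IsSymm) :
    ∫ x, (centeredOuter x * Q).trace ^ 2 ∂γ = 2 * ‖Q‖ ^ 2 := by
  have hi : ∀ a b : ι × ι, Integrable (fun x ↦ (Q a.2 a.1 * centeredOuter x a.1 a.2)
      * (Q b.2 b.1 * centeredOuter x b.1 b.2)) γ := fun a b ↦
    ((memLp_centeredOuter_apply _ _).const_mul _).integrable_mul
      ((memLp_centeredOuter_apply _ _).const_mul _)
  simp_rw [trace_mul_eq_sum, sq, Finset.sum_mul_sum]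
  rw [integral_sum_sum hi]
  simp_rw [mul_mul_mul_comm (Q _ _), integral_const_mul,
    integral_centeredOuter_mul, Fintype.sum_prod_type, Matrix.one_apply]
  simp [frobenius_norm_sq, mul_add, Finset.sum_add_distrib, hQ.apply, two_mul, ← pow_two]

end StandardCoordinates

section Weight

variable {m n : Type*}

/-- The matrix whose columns, stacked, form the vector `x`: the inverse of `Matrix.vec` on
Euclidean space. -/
def unvec (x : EuclideanSpace ℝ (n × m)) : Matrix m n ℝ :=
  Matrix.of fun i j ↦ x (j, i)

lemma unvec_sub (x y : EuclideanSpace ℝ (n × m)) : unvec (x - y) = unvec x - unvec y := rfl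

variable [Fintype m] [Fintype n]

lemma norm_unvec (x : EuclideanSpace ℝ (n × m)) : ‖unvec x‖ = ‖x‖ := by
  rw [← sq_eq_sq₀ (norm_nonneg _) (norm_nonneg _), frobenius_norm_sq,
    EuclideanSpace.real_norm_sq_eq, Fintype.sum_prod_type_right]
  rfl

lemma trace_mul_transpose_self (Z : Matrix m n ℝ) : (Z * Zᵀ).trace = ‖Z‖ ^ 2 := by
  simp [frobenius_norm_sq, Matrix.trace, Matrix.mul_apply, ← sq]

lemma norm_kronecker {k l : Type*} [Fintype k] [Fintype l] (A : Matrix k l ℝ) (B : Matrix m n ℝ) :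
    ‖A ⊗ₖ B‖ = ‖A‖ * ‖B‖ := by
  rw [← sq_eq_sq₀ (norm_nonneg _) (by positivity), mul_pow]
  simp only [frobenius_norm_sq, Fintype.sum_prod_type, Matrix.kroneckerMap_apply, mul_pow,
    ← Finset.mul_sum, ← Finset.sum_mul]

variable [DecidableEq m] [DecidableEq n]

lemma norm_one_sq : ‖(1 : Matrix m m ℝ)‖ ^ 2 = Fintype.card m := by
  rw [← trace_mul_transpose_self, Matrix.transpose_one, mul_one, Matrix.trace_one]

/-- The matrix `w(Z)` for which `-tr (D * w(Z))` is the first-order change of the flip-flop distance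
at `Z` when the empirical covariance of the vectorized data moves from `1` to `1 + D`. -/
def weight (Z : Matrix m n ℝ) : Matrix (n × m) (n × m) ℝ :=
  (Fintype.card n : ℝ)⁻¹ • (1 ⊗ₖ (Z * Zᵀ)) + (Fintype.card m : ℝ)⁻¹ • ((Zᵀ * Z) ⊗ₖ 1)
    - (Fintype.card m * Fintype.card n : ℝ)⁻¹ • ‖Z‖ ^ 2 • 1

lemma isSymm_weight (Z : Matrix m n ℝ) : (weight Z).IsSymm := by
  simp [Matrix.IsSymm, weight, ← Matrix.kroneckerMap_transpose]

lemma norm_weight_sq_le [Nonempty m] [Nonempty n] (Z : Matrix m n ℝ) :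
    ‖weight Z‖ ^ 2 ≤ 3 * (‖Z * Zᵀ‖ ^ 2 / Fintype.card n + ‖Zᵀ * Z‖ ^ 2 / Fintype.card m
      + ‖Z‖ ^ 4 / (Fintype.card m * Fintype.card n)) := by
  have key : ∀ x y z : ℝ, (x + y + z) ^ 2 ≤ 3 * (x ^ 2 + y ^ 2 + z ^ 2) := fun x y z ↦ by
    nlinarith [sq_nonneg (x - y), sq_nonneg (y - z), sq_nonneg (x - z)]
  calc ‖weight Z‖ ^ 2
      ≤ (‖(Fintype.card n : ℝ)⁻¹ • ((1 : Matrix n n ℝ) ⊗ₖ (Z * Zᵀ))‖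
        + ‖(Fintype.card m : ℝ)⁻¹ • ((Zᵀ * Z) ⊗ₖ (1 : Matrix m m ℝ))‖
        + ‖(Fintype.card m * Fintype.card n : ℝ)⁻¹ • ‖Z‖ ^ 2 • (1 : Matrix (n × m) (n × m) ℝ)‖)
        ^ 2 := by
        gcongr
        exact (norm_sub_le _ _).trans (add_le_add_left (norm_add_le _ _) _)
    _ ≤ _ := key _ _ _
    _ = _ := by
        simp only [norm_smul, norm_kronecker, mul_pow, norm_one_sq, norm_inv, Real.norm_natCast,
          Fintype.card_prod, norm_mul, norm_pow, norm_norm]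
        push_cast
        field_simp

end Weight

section GramMoments

variable {ι a b : Type*} [Fintype ι] [Fintype a] [Fintype b]

local notation "γ" => stdGaussian (EuclideanSpace ℝ ι)

lemma memLp_sum_apply_mul_apply (u v : b → ι) :
    MemLp (fun x : EuclideanSpace ℝ ι ↦ ∑ j, x (u j) * x (v j)) 2 γ :=
  memLp_finsetSum _ fun _ _ ↦ memLp_apply_mul_apply _ _

lemma integral_sum_sq_gram_eq (e : a × b ≃ ι) :
    ∫ x : EuclideanSpace ℝ ι, ∑ i, ∑ i', (∑ j, x (e (i, j)) * x (e (i', j))) ^ 2 ∂γ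
      = Fintype.card a * Fintype.card b * (Fintype.card a + Fintype.card b + 1) := by
  classical
  have hi : ∀ i i', Integrable (fun x : EuclideanSpace ℝ ι ↦
      (∑ j, x (e (i, j)) * x (e (i', j))) ^ 2) γ :=
    fun i i' ↦ (memLp_sum_apply_mul_apply _ _).integrable_sq
  rw [integral_sum_sum hi]
  have hterm : ∀ i i', ∫ x : EuclideanSpace ℝ ι, (∑ j, x (e (i, j)) * x (e (i', j))) ^ 2 ∂γ
      = ∑ j, ∑ j', ((if i = i' then 1 else 0) + (if j = j' then 1 else 0)
        + if i = i' ∧ j = j' then 1 else 0 : ℝ) := fun i i' ↦ by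
    simp_rw [sq, Finset.sum_mul_sum]
    rw [integral_sum_sum fun j j' ↦ integrable_apply_mul_four _ _ _ _]
    refine Finset.sum_congr rfl fun j _ ↦ Finset.sum_congr rfl fun j' _ ↦ ?_
    rw [integral_apply_mul_four]
    by_cases hi : i = i' <;> by_cases hj : j = j' <;>
      simp [Matrix.one_apply, hi, hj]
  simp_rw [hterm, ite_and]
  simp [Finset.sum_add_distrib]
  ring

lemma integral_norm_sq_stdGaussian :
    ∫ x : EuclideanSpace ℝ ι, ‖x‖ ^ 2 ∂γ = Fintype.card ι := by
  classical
  simp only [EuclideanSpace.real_norm_sq_eq]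
  simp only [sq]
  rw [integral_finsetSum _ fun i _ ↦ (memLp_apply_mul_apply i i).integrable (by norm_num)]
  simp [integral_apply_mul_apply]

lemma integral_norm_pow_four_eq :
    ∫ x : EuclideanSpace ℝ ι, ‖x‖ ^ 4 ∂γ = Fintype.card ι * (Fintype.card ι + 2) := by
  have h := integral_sum_sq_gram_eq (Equiv.punitProd.{0} ι)
  simp only [Equiv.punitProd_apply, Finset.univ_unique, Finset.sum_singleton, ← sq,
    ← EuclideanSpace.real_norm_sq_eq, ← pow_mul, Fintype.card_unique] at h
  refine h.trans ?_
  push_cast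
  ring

end GramMoments

section WeightMoments

variable {m n : Type*} [Fintype m] [Fintype n]

local notation "γ" => stdGaussian (EuclideanSpace ℝ (n × m))

lemma memLp_unvec_mul_transpose_apply (i i' : m) :
    MemLp (fun x : EuclideanSpace ℝ (n × m) ↦ (unvec x * (unvec x)ᵀ) i i') 2 γ := by
  simpa [Matrix.mul_apply, unvec] using memLp_sum_apply_mul_apply (fun j : n ↦ (j, i)) (·, i')

lemma memLp_transpose_mul_unvec_apply (j j' : n) :
    MemLp (fun x : EuclideanSpace ℝ (n × m) ↦ ((unvec x)ᵀ * unvec x) j j') 2 γ := by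
  simpa [Matrix.mul_apply, unvec] using memLp_sum_apply_mul_apply (fun i : m ↦ (j, i)) (j', ·)

lemma integrable_norm_unvec_mul_transpose_sq :
    Integrable (fun x : EuclideanSpace ℝ (n × m) ↦ ‖unvec x * (unvec x)ᵀ‖ ^ 2) γ := by
  simp only [frobenius_norm_sq]
  exact integrable_finsetSum _ fun i _ ↦ integrable_finsetSum _ fun i' _ ↦
    (memLp_unvec_mul_transpose_apply i i').integrable_sq

lemma integrable_norm_transpose_mul_unvec_sq :
    Integrable (fun x : EuclideanSpace ℝ (n × m) ↦ ‖(unvec x)ᵀ * unvec x‖ ^ 2) γ := by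
  simp only [frobenius_norm_sq]
  exact integrable_finsetSum _ fun j _ ↦ integrable_finsetSum _ fun j' _ ↦
    (memLp_transpose_mul_unvec_apply j j').integrable_sq

lemma integral_norm_unvec_mul_transpose_sq :
    ∫ x : EuclideanSpace ℝ (n × m), ‖unvec x * (unvec x)ᵀ‖ ^ 2 ∂γ
      = Fintype.card m * Fintype.card n * (Fintype.card m + Fintype.card n + 1) := by
  simpa [frobenius_norm_sq, Matrix.mul_apply, unvec] using
    integral_sum_sq_gram_eq (Equiv.prodComm m n)

lemma integral_norm_transpose_mul_unvec_sq :
    ∫ x : EuclideanSpace ℝ (n × m), ‖(unvec x)ᵀ * unvec x‖ ^ 2 ∂γ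
      = Fintype.card n * Fintype.card m * (Fintype.card n + Fintype.card m + 1) := by
  simpa [frobenius_norm_sq, Matrix.mul_apply, unvec] using
    integral_sum_sq_gram_eq (Equiv.refl (n × m))

lemma memLp_norm_unvec_sq :
    MemLp (fun x : EuclideanSpace ℝ (n × m) ↦ ‖unvec x‖ ^ 2) 2 γ := by
  simp only [norm_unvec, EuclideanSpace.real_norm_sq_eq]
  simp only [sq]
  exact memLp_sum_apply_mul_apply (fun a : n × m ↦ a) (fun a ↦ a)

variable [DecidableEq m] [DecidableEq n]

lemma memLp_weight_apply (a b : n × m) :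
    MemLp (fun x ↦ weight (unvec x) a b) 2 γ := by
  simp only [weight, Matrix.sub_apply, Matrix.add_apply, Matrix.smul_apply, smul_eq_mul,
    Matrix.kroneckerMap_apply]
  exact (((memLp_unvec_mul_transpose_apply _ _).const_mul _).const_mul _).add
    (((memLp_transpose_mul_unvec_apply _ _).mul_const _).const_mul _) |>.sub
    ((memLp_norm_unvec_sq.mul_const _).const_mul _)

lemma integrable_norm_weight_sq : Integrable (fun x ↦ ‖weight (unvec x)‖ ^ 2) γ := by
  simp only [frobenius_norm_sq]
  exact integrable_finsetSum _ fun a _ ↦ integrable_finsetSum _ fun b _ ↦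
    (memLp_weight_apply a b).integrable_sq

lemma integral_norm_weight_sq_le [Nonempty m] [Nonempty n] :
    ∫ x, ‖weight (unvec x)‖ ^ 2 ∂γ ≤ 7 * (Fintype.card m + Fintype.card n : ℝ) ^ 2 := by
  have hrow := (integrable_norm_unvec_mul_transpose_sq (m := m) (n := n)).div_const (Fintype.card n)
  have hcol := (integrable_norm_transpose_mul_unvec_sq (m := m) (n := n)).div_const (Fintype.card m)
  have hnorm : Integrable (fun x : EuclideanSpace ℝ (n × m) ↦
      ‖unvec x‖ ^ 4 / (Fintype.card m * Fintype.card n)) γ := by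
    simpa [← pow_mul] using memLp_norm_unvec_sq.integrable_sq.div_const _
  have hgram : Integrable (fun x : EuclideanSpace ℝ (n × m) ↦
      ‖unvec x * (unvec x)ᵀ‖ ^ 2 / (Fintype.card n : ℝ)
        + ‖(unvec x)ᵀ * unvec x‖ ^ 2 / (Fintype.card m : ℝ)) γ := hrow.add hcol
  calc ∫ x, ‖weight (unvec x)‖ ^ 2 ∂γ
      ≤ ∫ x : EuclideanSpace ℝ (n × m), 3 * (‖unvec x * (unvec x)ᵀ‖ ^ 2 / Fintype.card n
        + ‖(unvec x)ᵀ * unvec x‖ ^ 2 / Fintype.card m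
        + ‖unvec x‖ ^ 4 / (Fintype.card m * Fintype.card n)) ∂γ :=
        integral_mono integrable_norm_weight_sq ((hgram.add hnorm).const_mul 3)
          fun x ↦ norm_weight_sq_le (unvec x)
    _ = 3 * (Fintype.card m * (Fintype.card m + Fintype.card n + 1)
        + Fintype.card n * (Fintype.card m + Fintype.card n + 1)
        + (Fintype.card m * Fintype.card n + 2)) := by
        rw [integral_const_mul, integral_add hgram hnorm, integral_add hrow hcol]
        simp only [integral_div, integral_norm_unvec_mul_transpose_sq,
          integral_norm_transpose_mul_unvec_sq, norm_unvec, integral_norm_pow_four_eq,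
          Fintype.card_prod, Nat.cast_mul]
        field_simp
        ring
    _ ≤ 7 * (Fintype.card m + Fintype.card n : ℝ) ^ 2 := by
        have hm : (1 : ℝ) ≤ Fintype.card m := by exact_mod_cast Fintype.card_pos
        have hn : (1 : ℝ) ≤ Fintype.card n := by exact_mod_cast Fintype.card_pos
        nlinarith [sq_nonneg (Fintype.card m - Fintype.card n : ℝ)]

/-- The degenerate kernel `h` for which `-N⁻¹ ∑ k, h (z n) (z k)` is the first-order term of the
flip-flop distance at the `n`-th whitened observation. -/
def scoreKernel (x y : EuclideanSpace ℝ (n × m)) : ℝ :=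
  (centeredOuter y * weight (unvec x)).trace + 2 * ⟪x, y⟫

lemma scoreKernel_eq_sum (x y : EuclideanSpace ℝ (n × m)) :
    scoreKernel x y = ∑ a : (n × m) × (n × m), weight (unvec x) a.2 a.1 * centeredOuter y a.1 a.2
      + 2 * ∑ a, x a * y a := by
  simp [scoreKernel, trace_mul_eq_sum, PiLp.inner_apply, mul_comm]

@[fun_prop]
lemma measurable_weight_apply (a b : n × m) :
    Measurable fun x ↦ weight (unvec x) a b := by
  simp only [weight, Matrix.sub_apply, Matrix.add_apply, Matrix.smul_apply, smul_eq_mul,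
    Matrix.kroneckerMap_apply, Matrix.mul_apply, Matrix.transpose_apply, unvec,
    Matrix.of_apply]
  fun_prop

lemma measurable_scoreKernel :
    Measurable fun p : EuclideanSpace ℝ (n × m) × EuclideanSpace ℝ (n × m) ↦
      scoreKernel p.1 p.2 := by
  simp only [scoreKernel_eq_sum]
  have hterm : ∀ a b : n × m, Measurable fun p : EuclideanSpace ℝ (n × m) × EuclideanSpace ℝ (n × m)
      ↦ weight (unvec p.1) b a * centeredOuter p.2 a b := fun a b ↦
    ((measurable_weight_apply b a).comp measurable_fst).mul
      ((measurable_centeredOuter_apply a b).comp measurable_snd)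
  fun_prop

lemma memLp_scoreKernel :
    MemLp (fun p : EuclideanSpace ℝ (n × m) × EuclideanSpace ℝ (n × m) ↦ scoreKernel p.1 p.2) 2
      (Measure.prod γ γ) := by
  have hmul : ∀ {f g : EuclideanSpace ℝ (n × m) → ℝ}, MemLp f 2 γ → MemLp g 2 γ →
      MemLp (fun p : EuclideanSpace ℝ (n × m) × EuclideanSpace ℝ (n × m) ↦ f p.1 * g p.2) 2
        (Measure.prod γ γ) := fun hf hg ↦
    (memLp_two_iff_integrable_sq (hf.1.comp_fst.mul hg.1.comp_snd)).2 <| by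
      simpa [mul_pow] using hf.integrable_sq.mul_prod hg.integrable_sq
  simp only [scoreKernel_eq_sum]
  exact (memLp_finsetSum _ fun a _ ↦
    hmul (memLp_weight_apply _ _) (memLp_centeredOuter_apply _ _)).add
    ((memLp_finsetSum _ fun a _ ↦ hmul (memLp_apply a) (memLp_apply a)).const_mul 2)

lemma integral_scoreKernel (x : EuclideanSpace ℝ (n × m)) : ∫ y, scoreKernel x y ∂γ = 0 := by
  have hinner := memLp_inner_stdGaussian x (p := 2) (by simp)
  unfold scoreKernel
  rw [integral_add ((memLp_trace_centeredOuter_mul _).integrable (by norm_num))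
    ((hinner.integrable (by norm_num)).const_mul 2), integral_trace_centeredOuter_mul,
    integral_const_mul, (hasLaw_inner_stdGaussian x).integral_eq]
  simp

lemma integral_sq_scoreKernel_right_le (x : EuclideanSpace ℝ (n × m)) :
    ∫ y, scoreKernel x y ^ 2 ∂γ ≤ 4 * ‖weight (unvec x)‖ ^ 2 + 8 * ‖x‖ ^ 2 := by
  have htrace := (memLp_trace_centeredOuter_mul (weight (unvec x))).integrable_sq.const_mul 2
  have hinner := (memLp_inner_stdGaussian x (p := 2) (by simp)).integrable_sq.const_mul 8
  calc ∫ y, scoreKernel x y ^ 2 ∂γ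
      ≤ ∫ y, 2 * (centeredOuter y * weight (unvec x)).trace ^ 2 + 8 * ⟪x, y⟫ ^ 2 ∂γ :=
        integral_mono_of_nonneg (.of_forall fun y ↦ sq_nonneg _) (htrace.add hinner)
          (.of_forall fun y ↦ by
            have := add_sq_le (a := (centeredOuter y * weight (unvec x)).trace) (b := 2 * ⟪x, y⟫)
            simp only [scoreKernel]
            linarith)
    _ = 4 * ‖weight (unvec x)‖ ^ 2 + 8 * ‖x‖ ^ 2 := by
        rw [integral_add htrace hinner, integral_const_mul, integral_const_mul,
          integral_sq_trace_centeredOuter_mul (isSymm_weight _), integral_inner_sq,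
          real_inner_self_eq_norm_sq]
        ring

lemma integral_sq_scoreKernel_le [Nonempty m] [Nonempty n] :
    ∫ p : EuclideanSpace ℝ (n × m) × EuclideanSpace ℝ (n × m), scoreKernel p.1 p.2 ^ 2
      ∂(Measure.prod γ γ) ≤ 30 * (Fintype.card m + Fintype.card n : ℝ) ^ 2 := by
  have hsq := (memLp_scoreKernel (m := m) (n := n)).integrable_sq
  have hweight := (integrable_norm_weight_sq (m := m) (n := n)).const_mul 4
  have hnorm := ((memLp_norm_unvec_sq (m := m) (n := n)).integrable (by norm_num)).const_mul 8
  simp only [norm_unvec] at hnorm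
  calc _ = ∫ x : EuclideanSpace ℝ (n × m), ∫ y, scoreKernel x y ^ 2 ∂γ ∂γ := integral_prod _ hsq
    _ ≤ ∫ x : EuclideanSpace ℝ (n × m), 4 * ‖weight (unvec x)‖ ^ 2 + 8 * ‖x‖ ^ 2 ∂γ :=
        integral_mono hsq.integral_prod_left (hweight.add hnorm) integral_sq_scoreKernel_right_le
    _ ≤ 4 * (7 * (Fintype.card m + Fintype.card n) ^ 2)
        + 8 * (Fintype.card n * Fintype.card m) := by
        rw [integral_add hweight hnorm, integral_const_mul, integral_const_mul,
          integral_norm_sq_stdGaussian, Fintype.card_prod, Nat.cast_mul]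
        gcongr
        exact integral_norm_weight_sq_le
    _ ≤ 30 * (Fintype.card m + Fintype.card n : ℝ) ^ 2 := by
        nlinarith [sq_nonneg (Fintype.card m - Fintype.card n : ℝ)]

end WeightMoments

section PosSemidef

variable {ι : Type*} [Fintype ι] {A S : Matrix ι ι ℝ}

open scoped MatrixOrder in
lemma exists_eq_transpose_mul_self (hA : A.PosSemidef) : ∃ B : Matrix ι ι ℝ, A = Bᵀ * B := by
  classical
  simpa [Matrix.star_eq_conjTranspose] using CStarAlgebra.nonneg_iff_eq_star_mul_self.mp hA.nonneg

lemma norm_le_trace (hA : A.PosSemidef) : ‖A‖ ≤ A.trace := by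
  obtain ⟨B, rfl⟩ := exists_eq_transpose_mul_self hA
  have htrace : (Bᵀ * B).trace = ‖Bᵀ‖ * ‖B‖ := by
    rw [Matrix.trace_mul_comm, trace_mul_transpose_self, Matrix.frobenius_norm_transpose, sq]
  exact htrace ▸ Matrix.frobenius_norm_mul _ _

lemma trace_mul_pos (hS : S.PosDef) (hA : A.PosSemidef) (hA0 : A ≠ 0) : 0 < (S * A).trace := by
  classical
  obtain ⟨C, hC⟩ := exists_eq_transpose_mul_self hS.posSemidef
  obtain ⟨B, rfl⟩ := exists_eq_transpose_mul_self hA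
  have hdet : IsUnit Cᵀ.det := by
    have := hS.det_pos.ne'
    rw [hC, Matrix.det_mul] at this
    exact (left_ne_zero_of_mul this).isUnit
  have htrace : (S * (Bᵀ * B)).trace = ‖B * Cᵀ‖ ^ 2 := by
    rw [← trace_mul_transpose_self, hC, ← mul_assoc, Matrix.trace_mul_comm, Matrix.transpose_mul,
      Matrix.transpose_transpose]
    simp only [mul_assoc]
  rw [htrace, sq_pos_iff, norm_ne_zero_iff]
  intro h
  apply hA0
  rw [← Matrix.mul_nonsing_inv_cancel_right Cᵀ B hdet, h, zero_mul, mul_zero]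

lemma trace_mul_vecMulVec (A : Matrix ι ι ℝ) (u v : ι → ℝ) :
    (A * Matrix.vecMulVec u v).trace = v ⬝ᵥ A *ᵥ u := by
  rw [Matrix.mul_vecMulVec, Matrix.trace_vecMulVec, dotProduct_comm]

lemma isClosed_posSemidef {κ : Type*} [Finite κ] :
    IsClosed {A : Matrix κ κ ℝ | A.PosSemidef} := by
  cases nonempty_fintype κ
  simp only [Matrix.posSemidef_iff_dotProduct_mulVec, Set.ofPred_and, Set.ofPred_forall]
  refine .inter (isClosed_eq (by fun_prop) continuous_id) (isClosed_iInter fun x ↦ ?_)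
  exact isClosed_le continuous_const (by fun_prop)

lemma isCompact_posSemidef_trace_eq_one :
    IsCompact {A : Matrix ι ι ℝ | A.PosSemidef ∧ A.trace = 1} := by
  refine Metric.isCompact_of_isClosed_isBounded
    (isClosed_posSemidef.inter (isClosed_eq (by fun_prop) continuous_const)) ?_
  refine (Metric.isBounded_closedBall (x := 0) (r := 1)).subset fun A hA ↦ ?_
  rw [mem_closedBall_zero_iff, ← hA.2]
  exact norm_le_trace hA.1

lemma abs_trace_mul_le {κ : Type*} [Fintype κ] (A : Matrix ι κ ℝ) (B : Matrix κ ι ℝ) :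
    |(A * B).trace| ≤ ‖A‖ * ‖B‖ := by
  rw [trace_mul_eq_sum, ← sq_le_sq₀ (abs_nonneg _) (by positivity), sq_abs, mul_pow, mul_comm,
    ← Matrix.frobenius_norm_transpose B, frobenius_norm_sq, frobenius_norm_sq,
    ← Fintype.sum_prod_type', ← Fintype.sum_prod_type']
  exact Finset.sum_mul_sq_le_sq_mul_sq _ _ _

lemma norm_mul_transpose_self_le {κ : Type*} [Fintype κ] (W : Matrix ι κ ℝ) :
    ‖W * Wᵀ‖ ≤ ‖W‖ ^ 2 := by
  simpa [sq, Matrix.frobenius_norm_transpose] using Matrix.frobenius_norm_mul W Wᵀ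

lemma norm_vecMulVec_self (x : ι → ℝ) : ‖Matrix.vecMulVec x x‖ = x ⬝ᵥ x := by
  have hx : 0 ≤ x ⬝ᵥ x := Finset.sum_nonneg fun i _ ↦ mul_self_nonneg (x i)
  rw [← sq_eq_sq₀ (norm_nonneg _) hx, frobenius_norm_sq]
  simp only [Matrix.vecMulVec_apply, dotProduct, sq, Finset.sum_mul_sum]
  exact Finset.sum_congr rfl fun i _ ↦ Finset.sum_congr rfl fun j _ ↦ by ring

lemma posDef_of_norm_sub_one_lt [DecidableEq ι] (hS : S.IsHermitian) (h : ‖S - 1‖ < 1) :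
    S.PosDef := by
  refine .of_dotProduct_mulVec_pos hS fun x hx ↦ ?_
  have hpos : 0 < x ⬝ᵥ x := by simpa using Matrix.dotProduct_star_self_pos_iff.2 hx
  have hsplit : x ⬝ᵥ S *ᵥ x = ((S - 1) * Matrix.vecMulVec x x).trace + x ⬝ᵥ x := by
    rw [trace_mul_vecMulVec, Matrix.sub_mulVec, Matrix.one_mulVec, dotProduct_sub, sub_add_cancel]
  have hbound := abs_trace_mul_le (S - 1) (Matrix.vecMulVec x x)
  rw [norm_vecMulVec_self] at hbound
  rw [star_trivial, hsplit]
  nlinarith [neg_abs_le ((S - 1) * Matrix.vecMulVec x x).trace]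

end PosSemidef

section Contraction

variable {m n : Type*}

/-- Exchange of the two tensor factors of an operator on `ℝⁿ ⊗ ℝᵐ`. It turns statements about
contracting the first factor into statements about contracting the second. -/
def swapFactors : Matrix (n × m) (n × m) ℝ ≃ₗ[ℝ] Matrix (m × n) (m × n) ℝ :=
  Matrix.reindexLinearEquiv ℝ ℝ (Equiv.prodComm n m) (Equiv.prodComm n m)

lemma swapFactors_apply (S : Matrix (n × m) (n × m) ℝ) (a b : m × n) :
    swapFactors S a b = S a.swap b.swap := rfl

lemma posDef_swapFactors {S : Matrix (n × m) (n × m) ℝ} (hS : S.PosDef) :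
    (swapFactors S).PosDef :=
  hS.submatrix (Equiv.prodComm m n).injective

lemma swapFactors_one [DecidableEq m] [DecidableEq n] :
    swapFactors (1 : Matrix (n × m) (n × m) ℝ) = 1 :=
  Matrix.submatrix_one_equiv (Equiv.prodComm m n)

variable [Fintype n]

/-- Contraction of the first tensor factor of `S` against `q`, that is, the partial trace of
`S * (q ⊗ₖ 1)`. For the empirical covariance of vectorized matrices `Wₖ` it is the average of
`Wₖ * qᵀ * Wₖᵀ`. -/
def contract : Matrix (n × m) (n × m) ℝ →ₗ[ℝ] Matrix n n ℝ →ₗ[ℝ] Matrix m m ℝ :=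
  LinearMap.mk₂ ℝ (fun S q ↦ Matrix.of fun i i' ↦ ∑ j, ∑ j', S (j, i) (j', i') * q j' j)
    (fun S T q ↦ by ext; simp [add_mul, Finset.sum_add_distrib])
    (fun a S q ↦ by ext; simp [mul_assoc, Finset.mul_sum])
    (fun S q r ↦ by ext; simp [mul_add, Finset.sum_add_distrib])
    (fun a S q ↦ by ext; simp [mul_left_comm, Finset.mul_sum])

lemma contract_apply (S : Matrix (n × m) (n × m) ℝ) (q : Matrix n n ℝ) (i i' : m) :
    contract S q i i' = ∑ j, ∑ j', S (j, i) (j', i') * q j' j := rfl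

lemma transpose_contract (S : Matrix (n × m) (n × m) ℝ) (q : Matrix n n ℝ) :
    (contract S q)ᵀ = contract Sᵀ qᵀ := by
  ext i i'
  simp only [Matrix.transpose_apply, contract_apply]
  exact Finset.sum_comm

lemma contract_one [DecidableEq m] [DecidableEq n] (q : Matrix n n ℝ) :
    contract (1 : Matrix (n × m) (n × m) ℝ) q = q.trace • 1 := by
  ext i i'
  by_cases h : i = i' <;> simp [contract_apply, Matrix.one_apply, h, Matrix.trace]

variable [Fintype m]

lemma trace_contract_mul (S : Matrix (n × m) (n × m) ℝ) (q : Matrix n n ℝ) (p : Matrix m m ℝ) :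
    (contract S q * p).trace = (S * (q ⊗ₖ p)).trace := by
  simp only [Matrix.trace, Matrix.diag_apply, Matrix.mul_apply, contract_apply,
    Matrix.kroneckerMap_apply, Fintype.sum_prod_type, Finset.sum_mul, mul_assoc]
  rw [Finset.sum_comm (s := (Finset.univ : Finset n))]
  refine Finset.sum_congr rfl fun i _ ↦ Finset.sum_comm_cycle.symm.trans ?_
  refine Finset.sum_congr rfl fun j _ ↦ Finset.sum_congr rfl fun j' _ ↦
    Finset.sum_congr rfl fun i' _ ↦ by ring

lemma trace_swapFactors_mul (S : Matrix (n × m) (n × m) ℝ) (p : Matrix m m ℝ) (q : Matrix n n ℝ) :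
    (swapFactors S * (p ⊗ₖ q)).trace = (S * (q ⊗ₖ p)).trace := by
  simp only [trace_mul_eq_sum]
  refine Fintype.sum_equiv ((Equiv.prodComm m n).prodCongr (Equiv.prodComm m n)) _ _ fun a ↦ ?_
  simp [swapFactors_apply, mul_comm]

lemma norm_swapFactors (S : Matrix (n × m) (n × m) ℝ) : ‖swapFactors S‖ = ‖S‖ := by
  rw [← sq_eq_sq₀ (norm_nonneg _) (norm_nonneg _), frobenius_norm_sq, frobenius_norm_sq]
  exact Fintype.sum_equiv (Equiv.prodComm m n) _ _ fun a ↦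
    Fintype.sum_equiv (Equiv.prodComm m n) _ _ fun b ↦ rfl

lemma norm_contract_le (S : Matrix (n × m) (n × m) ℝ) (q : Matrix n n ℝ) :
    ‖contract S q‖ ≤ ‖S‖ * ‖q‖ := by
  rw [← sq_le_sq₀ (norm_nonneg _) (by positivity), mul_pow, frobenius_norm_sq]
  have hentry : ∀ i i', contract S q i i' ^ 2
      ≤ (∑ j, ∑ j', S (j, i) (j', i') ^ 2) * ‖q‖ ^ 2 := fun i i' ↦ by
    rw [contract_apply, ← Matrix.frobenius_norm_transpose q, frobenius_norm_sq]
    simp only [← Fintype.sum_prod_type']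
    exact Finset.sum_mul_sq_le_sq_mul_sq _ _ _
  refine (Finset.sum_le_sum fun i _ ↦ Finset.sum_le_sum fun i' _ ↦ hentry i i').trans_eq ?_
  simp only [← Finset.sum_mul, frobenius_norm_sq S, Fintype.sum_prod_type_right]
  exact congrArg (· * _) (Finset.sum_congr rfl fun i _ ↦ Finset.sum_comm)

lemma posDef_contract {k : Type*} [Finite k] {S : Matrix (n × k) (n × k) ℝ} {q : Matrix n n ℝ}
    (hS : S.PosDef) (hq : q.PosSemidef) (hq0 : q ≠ 0) : (contract S q).PosDef := by
  cases nonempty_fintype k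
  refine .of_dotProduct_mulVec_pos ?_ fun v hv ↦ ?_
  · rw [Matrix.IsHermitian, Matrix.conjTranspose_eq_transpose_of_trivial, transpose_contract]
    exact congrArg₂ (contract · ·) hS.isHermitian hq.isHermitian
  · rw [star_trivial, ← trace_mul_vecMulVec, trace_contract_mul]
    refine trace_mul_pos hS (hq.kronecker (Matrix.posSemidef_vecMulVec_self_star v)) ?_
    rw [← norm_ne_zero_iff, norm_kronecker, norm_vecMulVec_self]
    exact mul_ne_zero (norm_ne_zero_iff.2 hq0) (by simpa using hv)

end Contraction

section ScalingPair

variable {m n : Type*} [Fintype m] [Fintype n] [DecidableEq m] [DecidableEq n]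

/-- The flip-flop likelihood equations in terms of the precision matrices `p = Sc⁻¹`, `q = Sr⁻¹`,
when `S` is the empirical covariance `N⁻¹ ∑ k, vec Wₖ (vec Wₖ)ᵀ` of the vectorized centered data. -/
structure IsScalingPair (S : Matrix (n × m) (n × m) ℝ) (p : Matrix m m ℝ) (q : Matrix n n ℝ) :
    Prop where
  posDef_left : p.PosDef
  posDef_right : q.PosDef
  card_smul_inv_left : (Fintype.card n : ℝ) • p⁻¹ = contract S q
  card_smul_inv_right : (Fintype.card m : ℝ) • q⁻¹ = contract (swapFactors S) p

lemma hasDerivAt_det_one_add_smul (A : Matrix m m ℝ) :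
    HasDerivAt (fun t : ℝ ↦ (1 + t • A).det) A.trace 0 := by
  simp_rw [A.det_one_add_smul]
  have h := (((hasDerivAt_id' (0 : ℝ)).const_mul A.trace).const_add 1).fun_add
    (((Matrix.det (1 + (Polynomial.X : Polynomial ℝ) • A.map Polynomial.C)).divX.divX.hasDerivAt
      (0 : ℝ)).fun_mul ((hasDerivAt_id' (0 : ℝ)).fun_pow 2))
  simpa using h

lemma card_mul_trace_le_of_det_pow_le {A : Matrix m m ℝ} {B : Matrix n n ℝ} {k l : ℕ}
    (h : ∀ t : ℝ, 0 ≤ t → (1 + t • A).det ^ k ≤ (1 + t • B).det ^ l) :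
    k * A.trace ≤ l * B.trace := by
  have hderiv := ((hasDerivAt_det_one_add_smul B).pow l).sub
    ((hasDerivAt_det_one_add_smul A).pow k)
  have hslope := (hasDerivWithinAt_iff_tendsto_slope' (Set.self_notMem_Ioi)).1
    (hderiv.hasDerivWithinAt (s := Set.Ioi 0))
  have hnonneg := ge_of_tendsto hslope (b := 0) <| by
    filter_upwards [self_mem_nhdsWithin] with t ht
    have ht : (0 : ℝ) < t := ht
    simpa [slope_def_field] using div_nonneg (sub_nonneg.2 (h t ht.le)) ht.le
  simpa using hnonneg

lemma det_add_smul {A : Matrix m m ℝ} (hA : A.det ≠ 0) (B : Matrix m m ℝ) (t : ℝ) :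
    (A + t • B).det = A.det * (1 + t • (A⁻¹ * B)).det := by
  rw [← Matrix.det_mul, mul_add, mul_one, Matrix.mul_smul,
    Matrix.mul_nonsing_inv_cancel_left _ _ hA.isUnit]

variable [Nonempty n] {S : Matrix (n × m) (n × m) ℝ}

lemma card_mul_trace_inv_mul_le (hS : S.PosDef) {q₀ H : Matrix n n ℝ} (hq₀ : q₀.PosDef)
    (hmax : ∀ q : Matrix n n ℝ, q.PosSemidef → q ≠ 0 →
      q.det ^ Fintype.card m * (contract S q₀).det ^ Fintype.card n
        ≤ q₀.det ^ Fintype.card m * (contract S q).det ^ Fintype.card n)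
    (hH : H.PosSemidef) :
    Fintype.card m * (q₀⁻¹ * H).trace
      ≤ Fintype.card n * ((contract S q₀)⁻¹ * contract S H).trace := by
  have hC := posDef_contract hS hq₀.posSemidef hq₀.isUnit.ne_zero
  refine card_mul_trace_le_of_det_pow_le fun t ht ↦ ?_
  have hpos := hq₀.add_posSemidef (hH.smul ht)
  have h := hmax _ hpos.posSemidef hpos.isUnit.ne_zero
  rw [map_add, map_smul, det_add_smul hq₀.det_pos.ne', det_add_smul hC.det_pos.ne', mul_pow,
    mul_pow, mul_right_comm, ← mul_assoc] at h
  exact le_of_mul_le_mul_left h (mul_pos (pow_pos hq₀.det_pos _) (pow_pos hC.det_pos _))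

variable [Nonempty m]

lemma exists_posDef_maximizer (hS : S.PosDef) :
    ∃ q₀ : Matrix n n ℝ, q₀.PosDef ∧ ∀ q : Matrix n n ℝ, q.PosSemidef → q ≠ 0 →
      q.det ^ Fintype.card m * (contract S q₀).det ^ Fintype.card n
        ≤ q₀.det ^ Fintype.card m * (contract S q).det ^ Fintype.card n := by
  set K := {q : Matrix n n ℝ | q.PosSemidef ∧ q.trace = 1}
  set G : Matrix n n ℝ → ℝ :=
    fun q ↦ q.det ^ Fintype.card m / (contract S q).det ^ Fintype.card n
  have hne : ∀ q ∈ K, q ≠ 0 := by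
    rintro q ⟨-, hq⟩ rfl
    simp at hq
  have hden : ∀ {q : Matrix n n ℝ}, q.PosSemidef → q ≠ 0 →
      0 < (contract S q).det ^ Fintype.card n :=
    fun hq hq0 ↦ pow_pos (posDef_contract hS hq hq0).det_pos _
  have hcont : ContinuousOn G K := by
    have : Continuous (contract S) := (contract S).continuous_of_finiteDimensional
    exact ContinuousOn.div (by fun_prop) (by fun_prop) fun q hq ↦ (hden hq.1 (hne q hq)).ne'
  have hn : (0 : ℝ) < Fintype.card n := by exact_mod_cast Fintype.card_pos
  have hmem : (Fintype.card n : ℝ)⁻¹ • (1 : Matrix n n ℝ) ∈ K :=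
    ⟨Matrix.PosSemidef.one.smul (by positivity), by simp [hn.ne']⟩
  obtain ⟨q₀, hq₀, hmax⟩ := isCompact_posSemidef_trace_eq_one.exists_isMaxOn ⟨_, hmem⟩ hcont
  have hpos : q₀.PosDef := by
    rw [hq₀.1.posDef_iff_det_ne_zero]
    intro h0
    refine (hmax hmem).not_gt (?_ : G q₀ < _)
    have hGq₀ : G q₀ = 0 := by simp [G, h0]
    rw [hGq₀]
    refine div_pos (pow_pos ?_ _) (hden hmem.1 (hne _ hmem))
    simp only [Matrix.det_smul_of_tower, inv_pow, Matrix.det_one, smul_eq_mul, mul_one, inv_pos]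
    positivity
  refine ⟨q₀, hpos, fun q hq hq0 ↦ ?_⟩
  have htr : 0 < q.trace := (norm_pos_iff.2 hq0).trans_le (norm_le_trace hq)
  have hhom : G (q.trace⁻¹ • q) = G q := by
    simp only [G, map_smul, Matrix.det_smul, mul_pow, ← pow_mul, mul_comm (Fintype.card m)]
    exact mul_div_mul_left _ _ (by positivity)
  have hle : G (q.trace⁻¹ • q) ≤ G q₀ :=
    hmax ⟨hq.smul (by positivity), by simp [htr.ne']⟩
  rwa [hhom, div_le_div_iff₀ (hden hq hq0) (hden hpos.posSemidef hpos.isUnit.ne_zero)] at hle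

lemma exists_isScalingPair (hS : S.PosDef) : ∃ p q, IsScalingPair S p q := by
  obtain ⟨q₀, hq₀, hmax⟩ := exists_posDef_maximizer hS
  have hC := posDef_contract hS hq₀.posSemidef hq₀.isUnit.ne_zero
  set A : Matrix n n ℝ := (Fintype.card n : ℝ) • contract (swapFactors S) (contract S q₀)⁻¹
    - (Fintype.card m : ℝ) • q₀⁻¹
  have htrace : ∀ H, (A * H).trace = Fintype.card n * ((contract S q₀)⁻¹ * contract S H).trace
      - Fintype.card m * (q₀⁻¹ * H).trace := fun H ↦ by
    rw [sub_mul, Matrix.trace_sub, Matrix.smul_mul, Matrix.smul_mul, Matrix.trace_smul,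
      Matrix.trace_smul, trace_contract_mul, trace_swapFactors_mul, ← trace_contract_mul,
      Matrix.trace_mul_comm (contract S H), smul_eq_mul, smul_eq_mul]
  have hA : A.PosSemidef := by
    have hΨ := posDef_contract (posDef_swapFactors hS) hC.inv.posSemidef hC.inv.isUnit.ne_zero
    refine .of_dotProduct_mulVec_nonneg ?_ fun v ↦ ?_
    · exact (hΨ.isHermitian.smul (.all _)).sub (hq₀.inv.isHermitian.smul (.all _))
    · rw [star_trivial, ← trace_mul_vecMulVec, htrace, sub_nonneg]
      exact card_mul_trace_inv_mul_le hS hq₀ hmax (Matrix.posSemidef_vecMulVec_self_star v)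
  have hA0 : A = 0 := by
    by_contra hne
    have hpos := trace_mul_pos hq₀ hA hne
    rw [Matrix.trace_mul_comm, htrace, Matrix.nonsing_inv_mul _ hC.det_pos.ne'.isUnit,
      Matrix.nonsing_inv_mul _ hq₀.det_pos.ne'.isUnit, Matrix.trace_one, Matrix.trace_one,
      mul_comm, sub_self] at hpos
    exact hpos.false
  have hn : (0 : ℝ) < Fintype.card n := by exact_mod_cast Fintype.card_pos
  refine ⟨(Fintype.card n : ℝ) • (contract S q₀)⁻¹, q₀, hC.inv.smul hn, hq₀, ?_, ?_⟩
  · have := invertibleOfNonzero hn.ne'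
    rw [Matrix.inv_smul _ _ hC.inv.det_pos.ne'.isUnit, invOf_eq_inv, smul_inv_smul₀ hn.ne',
      Matrix.nonsing_inv_nonsing_inv _ hC.det_pos.ne'.isUnit]
  · rw [map_smul, sub_eq_zero.1 hA0]

end ScalingPair

section Expansion

variable {m n : Type*} [Fintype m] [Fintype n] [DecidableEq m] [DecidableEq n]
  {D : Matrix (n × m) (n × m) ℝ} {p : Matrix m m ℝ} {q : Matrix n n ℝ}

lemma norm_sub_one_le {A : Type*} [NormedRing A] {u e : A} (h : u * (1 + e) = 1) :
    ‖u - 1‖ ≤ ‖u‖ * ‖e‖ := by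
  have hue : u - 1 = -(u * e) := by rw [← h]; noncomm_ring
  rw [hue, norm_neg]
  exact norm_mul_le _ _

lemma norm_sub_one_add_le {A : Type*} [NormedRing A] {u e : A} (h : u * (1 + e) = 1) :
    ‖u - 1 + e‖ ≤ ‖u - 1‖ * ‖e‖ := by
  have hue : u * e = 1 - u := by rw [← h]; noncomm_ring
  have hsq : u - 1 + e = -((u - 1) * e) := by rw [sub_mul, hue]; noncomm_ring
  rw [hsq, norm_neg]
  exact norm_mul_le _ _

lemma norm_one_le_card : ‖(1 : Matrix m m ℝ)‖ ≤ Fintype.card m := by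
  simpa using norm_le_trace (Matrix.PosSemidef.one (n := m) (R := ℝ))

local notation "dₘ" => (Fintype.card m : ℝ)
local notation "dₙ" => (Fintype.card n : ℝ)

lemma norm_trace_smul_one_le (A : Matrix n n ℝ) :
    ‖A.trace • (1 : Matrix m m ℝ)‖ ≤ dₘ * dₙ * ‖A‖ := by
  have htr : |A.trace| ≤ ‖A‖ * dₙ := by
    simpa using (abs_trace_mul_le A 1).trans (by gcongr; exact norm_one_le_card)
  calc ‖A.trace • (1 : Matrix m m ℝ)‖ ≤ (‖A‖ * dₙ) * dₘ := by
        rw [norm_smul, Real.norm_eq_abs]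
        gcongr
        exact norm_one_le_card
    _ = _ := by ring

lemma trace_mul_transpose_sub_add (D : Matrix (n × m) (n × m) ℝ) (p : Matrix m m ℝ)
    (q : Matrix n n ℝ) (W : Matrix m n ℝ) :
    (p * W * q * Wᵀ).trace - ‖W‖ ^ 2 + (D * weight W).trace
      = ((p - 1 + dₙ⁻¹ • contract D 1 - (dₘ * dₙ)⁻¹ • D.trace • 1) * (W * Wᵀ)).trace
        + ((q - 1 + dₘ⁻¹ • contract (swapFactors D) 1) * (Wᵀ * W)).trace
        + ((p - 1) * W * ((q - 1) * Wᵀ)).trace := by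
  have hWW : (Wᵀ * W).trace = ‖W‖ ^ 2 := by rw [Matrix.trace_mul_comm, trace_mul_transpose_self]
  have hleft : (D * (1 ⊗ₖ (W * Wᵀ))).trace = (contract D 1 * (W * Wᵀ)).trace :=
    (trace_contract_mul _ _ _).symm
  have hright : (D * ((Wᵀ * W) ⊗ₖ 1)).trace = (contract (swapFactors D) 1 * (Wᵀ * W)).trace := by
    rw [trace_contract_mul, trace_swapFactors_mul]
  have hq : (q * (Wᵀ * W)).trace = (W * (q * Wᵀ)).trace := by
    rw [← Matrix.mul_assoc, Matrix.trace_mul_comm]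
  simp only [weight, mul_add, add_mul, mul_sub, sub_mul, Matrix.mul_smul, Matrix.smul_mul, mul_one,
    one_mul, Matrix.trace_add, Matrix.trace_sub, Matrix.trace_smul, smul_eq_mul, hleft, hright, hq,
    trace_mul_transpose_self, hWW, Matrix.mul_sub, Matrix.sub_mul, Matrix.one_mul,
    Matrix.mul_assoc]
  ring

namespace IsScalingPair

lemma smul {S : Matrix (n × m) (n × m) ℝ} (h : IsScalingPair S p q) {t : ℝ} (ht : 0 < t) :
    IsScalingPair S (t • p) (t⁻¹ • q) where
  posDef_left := h.posDef_left.smul ht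
  posDef_right := h.posDef_right.smul (inv_pos.2 ht)
  card_smul_inv_left := by
    have := invertibleOfNonzero ht.ne'
    rw [Matrix.inv_smul _ _ h.posDef_left.det_pos.ne'.isUnit, invOf_eq_inv, map_smul,
      ← h.card_smul_inv_left, smul_comm]
  card_smul_inv_right := by
    have := invertibleOfNonzero (inv_pos.2 ht).ne'
    rw [Matrix.inv_smul _ _ h.posDef_right.det_pos.ne'.isUnit, invOf_eq_inv, inv_inv, map_smul,
      ← h.card_smul_inv_right, smul_comm]

lemma norm_left_le (h : IsScalingPair (1 + D) p q) (htr : p.trace = dₘ) :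
    ‖p‖ ≤ dₘ :=
  htr ▸ norm_le_trace h.posDef_left.posSemidef

lemma right_mul_eq_one [Nonempty m] (h : IsScalingPair (1 + D) p q) (htr : p.trace = dₘ) :
    q * (1 + dₘ⁻¹ • contract (swapFactors D) p) = 1 := by
  have hm : dₘ ≠ 0 := by exact_mod_cast Fintype.card_ne_zero
  have hinv : q⁻¹ = 1 + dₘ⁻¹ • contract (swapFactors D) p := by
    rw [← inv_smul_smul₀ hm q⁻¹, h.card_smul_inv_right, map_add, map_add, swapFactors_one,
      LinearMap.add_apply, contract_one, htr, smul_add, inv_smul_smul₀ hm]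
  rw [← hinv, Matrix.mul_nonsing_inv _ h.posDef_right.det_pos.ne'.isUnit]

lemma left_mul_eq_one [Nonempty n] (h : IsScalingPair (1 + D) p q) :
    p * (1 + dₙ⁻¹ • ((q - 1).trace • 1 + contract D q)) = 1 := by
  have hn : dₙ ≠ 0 := by exact_mod_cast Fintype.card_ne_zero
  have hinv : p⁻¹ = 1 + dₙ⁻¹ • ((q - 1).trace • 1 + contract D q) := by
    rw [← inv_smul_smul₀ hn p⁻¹, h.card_smul_inv_left, map_add, LinearMap.add_apply,
      contract_one, Matrix.trace_sub, Matrix.trace_one, sub_smul, smul_add, smul_add, smul_sub,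
      inv_smul_smul₀ hn]
    abel
  rw [← hinv, Matrix.mul_nonsing_inv _ h.posDef_left.det_pos.ne'.isUnit]

variable [Nonempty m]

lemma norm_inv_card_smul_contract_le (h : IsScalingPair (1 + D) p q) (htr : p.trace = dₘ) :
    ‖dₘ⁻¹ • contract (swapFactors D) p‖ ≤ ‖D‖ := by
  have hm : 0 < dₘ := by exact_mod_cast Fintype.card_pos
  rw [norm_smul, norm_inv, Real.norm_of_nonneg hm.le, inv_mul_le_iff₀ hm, mul_comm,
    ← norm_swapFactors D]
  exact (norm_contract_le _ _).trans (by gcongr; exact h.norm_left_le htr)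

lemma norm_right_le (h : IsScalingPair (1 + D) p q) (htr : p.trace = dₘ) (hD : ‖D‖ ≤ 1 / 2) :
    ‖q‖ ≤ 2 * dₙ := by
  have hq := norm_sub_one_le (h.right_mul_eq_one htr)
  have he := (h.norm_inv_card_smul_contract_le htr).trans hD
  have hone : ‖(1 : Matrix n n ℝ)‖ ≤ dₙ := norm_one_le_card
  nlinarith [norm_sub_norm_le q 1, norm_nonneg q]

lemma norm_right_sub_one_le (h : IsScalingPair (1 + D) p q) (htr : p.trace = dₘ)
    (hD : ‖D‖ ≤ 1 / 2) : ‖q - 1‖ ≤ 2 * dₙ * ‖D‖ := by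
  refine (norm_sub_one_le (h.right_mul_eq_one htr)).trans ?_
  gcongr
  exacts [h.norm_right_le htr hD, h.norm_inv_card_smul_contract_le htr]

variable [Nonempty n]

lemma norm_inv_card_smul_trace_add_le (h : IsScalingPair (1 + D) p q) (htr : p.trace = dₘ)
    (hD : ‖D‖ ≤ 1 / 2) :
    ‖dₙ⁻¹ • ((q - 1).trace • 1 + contract D q)‖ ≤ 4 * dₘ * dₙ * ‖D‖ := by
  have hm : 1 ≤ dₘ := by exact_mod_cast Fintype.card_pos
  have hn : 1 ≤ dₙ := by exact_mod_cast Fintype.card_pos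
  rw [norm_smul, norm_inv, Real.norm_of_nonneg (by positivity), inv_mul_le_iff₀ (by positivity)]
  calc ‖(q - 1).trace • 1 + contract D q‖
      ≤ dₘ * dₙ * (2 * dₙ * ‖D‖) + ‖D‖ * (2 * dₙ) := by
        refine norm_add_le_of_le ((norm_trace_smul_one_le _).trans ?_)
          ((norm_contract_le _ _).trans ?_) <;> gcongr
        exacts [h.norm_right_sub_one_le htr hD, h.norm_right_le htr hD]
    _ ≤ dₙ * (4 * dₘ * dₙ * ‖D‖) := by
        have : 1 ≤ dₘ * dₙ := one_le_mul_of_one_le_of_one_le hm hn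
        nlinarith [mul_nonneg (norm_nonneg D) (zero_le_one.trans hn)]

lemma norm_left_sub_one_le (h : IsScalingPair (1 + D) p q) (htr : p.trace = dₘ)
    (hD : ‖D‖ ≤ 1 / 2) : ‖p - 1‖ ≤ 4 * dₘ ^ 2 * dₙ * ‖D‖ := by
  calc ‖p - 1‖ ≤ dₘ * (4 * dₘ * dₙ * ‖D‖) := by
        refine (norm_sub_one_le h.left_mul_eq_one).trans ?_
        gcongr
        exacts [h.norm_left_le htr, h.norm_inv_card_smul_trace_add_le htr hD]
    _ = _ := by ring

lemma norm_right_sub_one_add_le (h : IsScalingPair (1 + D) p q) (htr : p.trace = dₘ)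
    (hD : ‖D‖ ≤ 1 / 2) :
    ‖q - 1 + dₘ⁻¹ • contract (swapFactors D) 1‖ ≤ 6 * dₘ * dₙ * ‖D‖ ^ 2 := by
  have hm : 1 ≤ dₘ := by exact_mod_cast Fintype.card_pos
  have hsplit : q - 1 + dₘ⁻¹ • contract (swapFactors D) 1
      = (q - 1 + dₘ⁻¹ • contract (swapFactors D) p) - dₘ⁻¹ • contract (swapFactors D) (p - 1) := by
    rw [map_sub, smul_sub]
    abel
  have hquad : ‖q - 1 + dₘ⁻¹ • contract (swapFactors D) p‖ ≤ 2 * dₙ * ‖D‖ * ‖D‖ :=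
    (norm_sub_one_add_le (h.right_mul_eq_one htr)).trans <| by
      gcongr
      exacts [h.norm_right_sub_one_le htr hD, h.norm_inv_card_smul_contract_le htr]
  have hlin : ‖dₘ⁻¹ • contract (swapFactors D) (p - 1)‖ ≤ 4 * dₘ * dₙ * ‖D‖ ^ 2 := by
    rw [norm_smul, norm_inv, Real.norm_of_nonneg (by positivity), inv_mul_le_iff₀ (by positivity)]
    refine (norm_contract_le _ _).trans ?_
    rw [norm_swapFactors]
    nlinarith [mul_le_mul_of_nonneg_left (h.norm_left_sub_one_le htr hD) (norm_nonneg D)]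
  rw [hsplit]
  refine (norm_sub_le_of_le hquad hlin).trans ?_
  nlinarith [mul_nonneg (sq_nonneg ‖D‖) (Nat.cast_nonneg (α := ℝ) (Fintype.card n))]

lemma norm_left_sub_one_add_le (h : IsScalingPair (1 + D) p q) (htr : p.trace = dₘ)
    (hD : ‖D‖ ≤ 1 / 2) :
    ‖p - 1 + dₙ⁻¹ • contract D 1 - (dₘ * dₙ)⁻¹ • D.trace • 1‖
      ≤ 24 * dₘ ^ 3 * dₙ ^ 2 * ‖D‖ ^ 2 := by
  have hm : 1 ≤ dₘ := by exact_mod_cast Fintype.card_pos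
  have hn : 1 ≤ dₙ := by exact_mod_cast Fintype.card_pos
  set F := dₘ⁻¹ • contract (swapFactors D) 1 with hF
  have htrace : F.trace = dₘ⁻¹ * D.trace := by
    have := trace_contract_mul (swapFactors D) (1 : Matrix m m ℝ) (1 : Matrix n n ℝ)
    rw [trace_swapFactors_mul, Matrix.one_kronecker_one, mul_one, mul_one] at this
    rw [hF, Matrix.trace_smul, this, smul_eq_mul]
  have hsplit : p - 1 + dₙ⁻¹ • contract D 1 - (dₘ * dₙ)⁻¹ • D.trace • 1
      = (p - 1 + dₙ⁻¹ • ((q - 1).trace • 1 + contract D q))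
        - dₙ⁻¹ • ((q - 1 + F).trace • 1 + contract D (q - 1)) := by
    rw [Matrix.trace_add, htrace, map_sub, mul_inv]
    module
  have hquad := (norm_sub_one_add_le h.left_mul_eq_one).trans
    (mul_le_mul (h.norm_left_sub_one_le htr hD) (h.norm_inv_card_smul_trace_add_le htr hD)
      (norm_nonneg _) (by positivity))
  have hlin : ‖dₙ⁻¹ • ((q - 1 + F).trace • (1 : Matrix m m ℝ) + contract D (q - 1))‖
      ≤ 8 * dₘ ^ 2 * dₙ * ‖D‖ ^ 2 := by
    rw [norm_smul, norm_inv, Real.norm_of_nonneg (by positivity), inv_mul_le_iff₀ (by positivity)]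
    calc _ ≤ dₘ * dₙ * (6 * dₘ * dₙ * ‖D‖ ^ 2) + ‖D‖ * (2 * dₙ * ‖D‖) := by
          refine norm_add_le_of_le ((norm_trace_smul_one_le _).trans ?_)
            ((norm_contract_le _ _).trans ?_) <;> gcongr
          exacts [h.norm_right_sub_one_add_le htr hD, h.norm_right_sub_one_le htr hD]
      _ ≤ _ := by
          have : 1 ≤ dₘ ^ 2 * dₙ := one_le_mul_of_one_le_of_one_le (one_le_pow₀ hm) hn
          nlinarith [mul_le_mul_of_nonneg_left this (by positivity : 0 ≤ dₙ * ‖D‖ ^ 2)]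
  rw [hsplit]
  refine (norm_sub_le_of_le hquad hlin).trans ?_
  have : 1 ≤ dₘ * dₙ := one_le_mul_of_one_le_of_one_le hm hn
  nlinarith [mul_le_mul_of_nonneg_left this (by positivity : 0 ≤ dₘ ^ 2 * dₙ * ‖D‖ ^ 2)]

lemma abs_trace_sub_le_of_trace_eq (h : IsScalingPair (1 + D) p q) (htr : p.trace = dₘ)
    (hD : ‖D‖ ≤ 1 / 2) (W : Matrix m n ℝ) :
    |(p * W * q * Wᵀ).trace - ‖W‖ ^ 2 + (D * weight W).trace|
      ≤ 38 * dₘ ^ 3 * dₙ ^ 2 * ‖D‖ ^ 2 * ‖W‖ ^ 2 := by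
  have hm : 1 ≤ dₘ := by exact_mod_cast Fintype.card_pos
  have hn : 1 ≤ dₙ := by exact_mod_cast Fintype.card_pos
  have hleft := (abs_trace_mul_le _ (W * Wᵀ)).trans (mul_le_mul
    (h.norm_left_sub_one_add_le htr hD) (norm_mul_transpose_self_le W) (norm_nonneg _)
    (by positivity))
  have hright := (abs_trace_mul_le _ (Wᵀ * W)).trans (mul_le_mul
    (h.norm_right_sub_one_add_le htr hD) (norm_mul_transpose_self_le Wᵀ) (norm_nonneg _)
    (by positivity))
  have hcross : |((p - 1) * W * ((q - 1) * Wᵀ)).trace|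
      ≤ 8 * dₘ ^ 2 * dₙ ^ 2 * ‖D‖ ^ 2 * ‖W‖ ^ 2 := by
    have hp := (Matrix.frobenius_norm_mul (p - 1) W).trans
      (mul_le_mul_of_nonneg_right (h.norm_left_sub_one_le htr hD) (norm_nonneg W))
    have hq := (Matrix.frobenius_norm_mul (q - 1) Wᵀ).trans
      (mul_le_mul_of_nonneg_right (h.norm_right_sub_one_le htr hD) (norm_nonneg Wᵀ))
    rw [Matrix.frobenius_norm_transpose] at hq
    exact (abs_trace_mul_le _ _).trans
      ((mul_le_mul hp hq (norm_nonneg _) (by positivity)).trans_eq (by ring))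
  rw [Matrix.frobenius_norm_transpose] at hright
  rw [trace_mul_transpose_sub_add]
  refine (abs_add_three _ _ _).trans ((add_le_add_three hleft hright hcross).trans ?_)
  have hmn : dₘ ^ 1 * dₙ ^ 1 ≤ dₘ ^ 3 * dₙ ^ 2 := by gcongr <;> norm_num
  have hm2 : dₘ ^ 2 * dₙ ^ 2 ≤ dₘ ^ 3 * dₙ ^ 2 := by gcongr; norm_num
  have hDW : 0 ≤ ‖D‖ ^ 2 * ‖W‖ ^ 2 := by positivity
  nlinarith [mul_le_mul_of_nonneg_right hmn hDW, mul_le_mul_of_nonneg_right hm2 hDW]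

lemma abs_trace_sub_le (h : IsScalingPair (1 + D) p q) (hD : ‖D‖ ≤ 1 / 2) (W : Matrix m n ℝ) :
    |(p * W * q * Wᵀ).trace - ‖W‖ ^ 2 + (D * weight W).trace|
      ≤ 38 * dₘ ^ 3 * dₙ ^ 2 * ‖D‖ ^ 2 * ‖W‖ ^ 2 := by
  have hp : 0 < p.trace := h.posDef_left.trace_pos
  have hm : 0 < dₘ := by exact_mod_cast Fintype.card_pos
  have hscale := (h.smul (div_pos hm hp)).abs_trace_sub_le_of_trace_eq
    (by rw [Matrix.trace_smul, smul_eq_mul, div_mul_cancel₀ _ hp.ne']) hD W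
  simpa only [Matrix.smul_mul, Matrix.mul_smul, inv_smul_smul₀ (div_pos hm hp).ne'] using hscale

end IsScalingPair

end Expansion

section WeightBounds

variable {m n : Type*} [Fintype m] [Fintype n]

lemma norm_mul_transpose_sub_le (X Y : Matrix m n ℝ) :
    ‖X * Xᵀ - Y * Yᵀ‖ ≤ ‖X - Y‖ * (‖X‖ + ‖Y‖) := by
  have hsplit : X * Xᵀ - Y * Yᵀ = X * (X - Y)ᵀ + (X - Y) * Yᵀ := by
    simp only [Matrix.transpose_sub, Matrix.mul_sub, Matrix.sub_mul]
    abel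
  rw [hsplit]
  refine (norm_add_le_of_le (Matrix.frobenius_norm_mul _ _)
    (Matrix.frobenius_norm_mul _ _)).trans_eq ?_
  rw [Matrix.frobenius_norm_transpose, Matrix.frobenius_norm_transpose]
  ring

variable [DecidableEq m] [DecidableEq n]

lemma norm_weight_sub_le [Nonempty m] [Nonempty n] (X Y : Matrix m n ℝ) :
    ‖weight X - weight Y‖ ≤ 3 * (‖X - Y‖ * (‖X‖ + ‖Y‖)) := by
  have hm : (0 : ℝ) < Fintype.card m := by exact_mod_cast Fintype.card_pos
  have hn : (0 : ℝ) < Fintype.card n := by exact_mod_cast Fintype.card_pos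
  have hsplit : weight X - weight Y
      = (Fintype.card n : ℝ)⁻¹ • (1 ⊗ₖ (X * Xᵀ - Y * Yᵀ))
        + (Fintype.card m : ℝ)⁻¹ • ((Xᵀ * X - Yᵀ * Y) ⊗ₖ 1)
        - (Fintype.card m * Fintype.card n : ℝ)⁻¹ • (‖X‖ ^ 2 - ‖Y‖ ^ 2) • 1 := by
    ext
    simp only [weight, Matrix.sub_apply, Matrix.add_apply, Matrix.smul_apply,
      Matrix.kroneckerMap_apply, smul_eq_mul]
    ring
  have hrow : ‖(Fintype.card n : ℝ)⁻¹ • ((1 : Matrix n n ℝ) ⊗ₖ (X * Xᵀ - Y * Yᵀ))‖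
      ≤ ‖X - Y‖ * (‖X‖ + ‖Y‖) := by
    rw [norm_smul, norm_kronecker, norm_inv, Real.norm_natCast, inv_mul_le_iff₀ hn]
    gcongr
    exacts [norm_one_le_card, norm_mul_transpose_sub_le X Y]
  have hcol : ‖(Fintype.card m : ℝ)⁻¹ • ((Xᵀ * X - Yᵀ * Y) ⊗ₖ (1 : Matrix m m ℝ))‖
      ≤ ‖X - Y‖ * (‖X‖ + ‖Y‖) := by
    rw [norm_smul, norm_kronecker, norm_inv, Real.norm_natCast, inv_mul_le_iff₀ hm, mul_comm]
    gcongr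
    · exact norm_one_le_card
    · simpa only [Matrix.transpose_transpose, ← Matrix.transpose_sub,
        Matrix.frobenius_norm_transpose] using norm_mul_transpose_sub_le Xᵀ Yᵀ
  have hnorm : ‖(Fintype.card m * Fintype.card n : ℝ)⁻¹ •
      (‖X‖ ^ 2 - ‖Y‖ ^ 2) • (1 : Matrix (n × m) (n × m) ℝ)‖ ≤ ‖X - Y‖ * (‖X‖ + ‖Y‖) := by
    have hone : ‖(1 : Matrix (n × m) (n × m) ℝ)‖ ≤ Fintype.card m * Fintype.card n :=
      norm_one_le_card.trans_eq (by rw [Fintype.card_prod, Nat.cast_mul, mul_comm])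
    have hsq : |‖X‖ ^ 2 - ‖Y‖ ^ 2| ≤ ‖X - Y‖ * (‖X‖ + ‖Y‖) := by
      rw [sq_sub_sq, abs_mul, abs_of_nonneg (by positivity : 0 ≤ ‖X‖ + ‖Y‖), mul_comm]
      gcongr
      exact abs_norm_sub_norm_le X Y
    rw [norm_smul, norm_smul, norm_inv, Real.norm_of_nonneg (by positivity), Real.norm_eq_abs,
      inv_mul_le_iff₀ (by positivity), mul_comm]
    exact mul_le_mul hone hsq (abs_nonneg _) (by positivity)
  rw [hsplit]
  linarith [norm_sub_le_of_le (norm_add_le_of_le hrow hcol) hnorm]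

lemma norm_weight_le [Nonempty m] [Nonempty n] (X : Matrix m n ℝ) : ‖weight X‖ ≤ 3 * ‖X‖ ^ 2 := by
  simpa [weight, sq] using norm_weight_sub_le X 0

lemma abs_trace_mul_weight_le [Nonempty m] [Nonempty n] (A : Matrix (n × m) (n × m) ℝ)
    (X : Matrix m n ℝ) : |(A * weight X).trace| ≤ ‖A‖ * (3 * ‖X‖ ^ 2) :=
  (abs_trace_mul_le _ _).trans (by gcongr; exact norm_weight_le X)

lemma abs_trace_mul_weight_sub_le [Nonempty m] [Nonempty n] (A : Matrix (n × m) (n × m) ℝ)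
    (X Y : Matrix m n ℝ) :
    |(A * (weight X - weight Y)).trace| ≤ ‖A‖ * (3 * (‖X - Y‖ * (‖X‖ + ‖Y‖))) :=
  (abs_trace_mul_le _ _).trans (by gcongr; exact norm_weight_sub_le X Y)

lemma abs_scoreKernel_le [Nonempty m] [Nonempty n] (x y : EuclideanSpace ℝ (n × m)) :
    |scoreKernel x y| ≤ ‖centeredOuter y‖ * (3 * ‖x‖ ^ 2) + 2 * (‖x‖ * ‖y‖) := by
  refine (abs_add_le _ _).trans (add_le_add ?_ ?_)
  · simpa only [norm_unvec] using abs_trace_mul_weight_le (centeredOuter y) (unvec x)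
  · rw [abs_mul, abs_two]
    gcongr
    exact abs_real_inner_le_norm x y

end WeightBounds

section DistanceExpansion

variable {m n : Type*} [Fintype m] [Fintype n] [DecidableEq m] [DecidableEq n]

local notation "dₘ" => (Fintype.card m : ℝ)
local notation "dₙ" => (Fintype.card n : ℝ)

lemma norm_vecMulVec_ofLp {ι : Type*} [Fintype ι] (y : EuclideanSpace ℝ ι) :
    ‖(Matrix.vecMulVec y y : Matrix ι ι ℝ)‖ = ‖y‖ ^ 2 := by
  rw [norm_vecMulVec_self, EuclideanSpace.real_norm_sq_eq]
  simp [dotProduct, sq]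

lemma trace_sub_add_eq (A P : Matrix (n × m) (n × m) ℝ) (x y : EuclideanSpace ℝ (n × m)) (t : ℝ) :
    t - ‖x‖ ^ 2 + ((A * weight (unvec x)).trace + 2 * ⟪x, y⟫)
      = (t - ‖x - y‖ ^ 2 + ((A - P) * weight (unvec (x - y))).trace) + ‖y‖ ^ 2
        - ((A - P) * (weight (unvec (x - y)) - weight (unvec x))).trace
        + (P * weight (unvec x)).trace := by
  rw [norm_sub_sq_real, mul_sub, sub_mul A P (weight (unvec x)), Matrix.trace_sub,
    Matrix.trace_sub]
  ring

lemma IsScalingPair.abs_trace_unvec_sub_le [Nonempty m] [Nonempty n]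
    {A : Matrix (n × m) (n × m) ℝ} {p : Matrix m m ℝ} {q : Matrix n n ℝ}
    {x y : EuclideanSpace ℝ (n × m)} {τ η : ℝ}
    (h : IsScalingPair (1 + (A - Matrix.vecMulVec y y)) p q)
    (hA : ‖A‖ ≤ τ * η) (hy : ‖y‖ ≤ τ * η) (hx : ‖x‖ ≤ τ) (hτ : 1 ≤ τ) (hτη : τ * η ≤ 1 / 4) :
    |(p * unvec (x - y) * q * (unvec (x - y))ᵀ).trace - ‖x‖ ^ 2
        + ((A * weight (unvec x)).trace + 2 * ⟪x, y⟫)|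
      ≤ 630 * dₘ ^ 3 * dₙ ^ 2 * τ ^ 4 * η ^ 2 := by
  set D := A - Matrix.vecMulVec y y
  have hm : 1 ≤ dₘ := by exact_mod_cast Fintype.card_pos
  have hn : 1 ≤ dₙ := by exact_mod_cast Fintype.card_pos
  have hη : 0 ≤ τ * η := (norm_nonneg y).trans hy
  have hyy : ‖Matrix.vecMulVec y y‖ ≤ (τ * η) ^ 2 := by
    rw [norm_vecMulVec_ofLp]
    gcongr
  have hD : ‖D‖ ≤ 2 * (τ * η) := by nlinarith [norm_sub_le_of_le hA hyy]
  have hW : ‖x - y‖ ≤ 2 * τ := by linarith [norm_sub_le_of_le hx hy]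
  have hexpand := h.abs_trace_sub_le (by linarith) (unvec (x - y))
  have hweight : |(D * (weight (unvec (x - y)) - weight (unvec x))).trace|
      ≤ 2 * (τ * η) * (3 * (τ * η * (3 * τ))) := by
    refine (abs_trace_mul_weight_sub_le _ _ _).trans ?_
    rw [← unvec_sub, norm_unvec, norm_unvec, norm_unvec, sub_sub_cancel_left, norm_neg]
    gcongr
    linarith
  have hmean : |(Matrix.vecMulVec y y * weight (unvec x)).trace| ≤ (τ * η) ^ 2 * (3 * τ ^ 2) := by
    refine (abs_trace_mul_weight_le _ _).trans ?_
    rw [norm_unvec]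
    gcongr
  rw [norm_unvec] at hexpand
  rw [trace_sub_add_eq A (Matrix.vecMulVec y y) x y]
  calc _ ≤ 38 * dₘ ^ 3 * dₙ ^ 2 * (2 * (τ * η)) ^ 2 * (2 * τ) ^ 2 + (τ * η) ^ 2
        + 2 * (τ * η) * (3 * (τ * η * (3 * τ))) + (τ * η) ^ 2 * (3 * τ ^ 2) := by
        refine (abs_add_le _ _).trans (add_le_add ((abs_sub _ _).trans
          (add_le_add ((abs_add_le _ _).trans (add_le_add (hexpand.trans ?_) ?_)) hweight)) hmean)
        · gcongr
        · rw [abs_of_nonneg (by positivity)]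
          gcongr
    _ ≤ _ := by
        have hmn : 1 ≤ dₘ ^ 3 * dₙ ^ 2 :=
          one_le_mul_of_one_le_of_one_le (one_le_pow₀ hm) (one_le_pow₀ hn)
        have h₂ : τ ^ 2 * η ^ 2 ≤ τ ^ 4 * η ^ 2 := by gcongr; norm_num
        have h₃ : τ ^ 3 * η ^ 2 ≤ τ ^ 4 * η ^ 2 := by gcongr; norm_num
        have h₄ := le_mul_of_one_le_right (by positivity : 0 ≤ τ ^ 4 * η ^ 2) hmn
        linarith

end DistanceExpansion

section SampleStatistics

variable {ι : Type*} {N : ℕ}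

/-- The mean of a sample in Euclidean space. -/
def sampleMean (z : Fin N → EuclideanSpace ℝ ι) : EuclideanSpace ℝ ι :=
  (N : ℝ)⁻¹ • ∑ k, z k

/-- The empirical covariance matrix of a sample, normalized by `1 / N` as in the likelihood
equations, whereas `vecCov` uses `1 / (N - 1)`. -/
def sampleCov (z : Fin N → EuclideanSpace ℝ ι) : Matrix ι ι ℝ :=
  (N : ℝ)⁻¹ • ∑ k, Matrix.vecMulVec (z k - sampleMean z) (z k - sampleMean z)

lemma isHermitian_sampleCov (z : Fin N → EuclideanSpace ℝ ι) : (sampleCov z).IsHermitian := by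
  ext i j
  simp [sampleCov, Matrix.sum_apply, Matrix.vecMulVec_apply, mul_comm]

variable [DecidableEq ι]

/-- The average of `centeredOuter` over a sample: the fluctuation of its second-moment matrix about
the second-moment matrix `1` of the standard Gaussian law. -/
def meanCenteredOuter (z : Fin N → EuclideanSpace ℝ ι) : Matrix ι ι ℝ :=
  (N : ℝ)⁻¹ • ∑ k, centeredOuter (z k)

lemma sampleCov_eq_one_add (hN : N ≠ 0) (z : Fin N → EuclideanSpace ℝ ι) :
    sampleCov z
      = 1 + (meanCenteredOuter z - Matrix.vecMulVec (sampleMean z) (sampleMean z)) := by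
  have hN' : (N : ℝ) ≠ 0 := by exact_mod_cast hN
  have hsum : ∀ i, ∑ k, z k i = N * sampleMean z i := fun i ↦ by
    simp [sampleMean, WithLp.ofLp_sum, Finset.sum_apply, mul_inv_cancel_left₀ hN']
  ext i j
  simp only [sampleCov, meanCenteredOuter, Matrix.smul_apply, Matrix.sum_apply, Matrix.add_apply,
    Matrix.sub_apply, centeredOuter_apply, Matrix.vecMulVec_apply, PiLp.sub_apply, smul_eq_mul,
    sub_mul, mul_sub, Finset.sum_sub_distrib, ← Finset.sum_mul, ← Finset.mul_sum, hsum,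
    Finset.sum_const, Finset.card_univ, Fintype.card_fin, nsmul_eq_mul]
  field_simp
  ring

variable [Fintype ι]

/-- The size of the random quantities that enter the error terms of the expansion at the
observation `z k`. -/
def fluctuation (z : Fin N → EuclideanSpace ℝ ι) (k : Fin N) : ℝ :=
  N * ‖meanCenteredOuter z‖ ^ 2 + N * ‖sampleMean z‖ ^ 2 + ‖z k‖ ^ 2

lemma fluctuation_nonneg (z : Fin N → EuclideanSpace ℝ ι) (k : Fin N) : 0 ≤ fluctuation z k := by
  unfold fluctuation
  positivity

lemma norm_le_of_fluctuation_le {z : Fin N → EuclideanSpace ℝ ι} {k : Fin N} {τ : ℝ} (hτ : 0 ≤ τ)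
    (hN : (0 : ℝ) < N) (hfluct : fluctuation z k ≤ τ ^ 2) :
    ‖meanCenteredOuter z‖ ≤ τ * (√N)⁻¹ ∧ ‖sampleMean z‖ ≤ τ * (√N)⁻¹ ∧ ‖z k‖ ≤ τ := by
  have hscale : ∀ x : ℝ, N * x ^ 2 ≤ τ ^ 2 → x ≤ τ * (√N)⁻¹ := fun x hx ↦ by
    rw [← div_eq_mul_inv, ← Real.sqrt_sq hτ, ← Real.sqrt_div (by positivity)]
    exact Real.le_sqrt_of_sq_le (by rwa [le_div_iff₀' hN])
  have houter := mul_nonneg hN.le (sq_nonneg ‖meanCenteredOuter z‖)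
  have hmean := mul_nonneg hN.le (sq_nonneg ‖sampleMean z‖)
  unfold fluctuation at hfluct
  exact ⟨hscale _ (by linarith [sq_nonneg ‖z k‖]), hscale _ (by linarith [sq_nonneg ‖z k‖]),
    le_of_sq_le_sq (by linarith) hτ⟩

lemma mul_inv_sqrt_le_quarter {τ x : ℝ} (hx : 0 < x) (h : 16 * τ ^ 2 ≤ x) :
    τ * (√x)⁻¹ ≤ 1 / 4 := by
  rw [← div_eq_mul_inv, div_le_iff₀ (Real.sqrt_pos.2 hx)]
  have : 4 * τ ≤ √x := Real.le_sqrt_of_sq_le (by linarith)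
  linarith

lemma posDef_sampleCov_of_fluctuation_le {z : Fin N → EuclideanSpace ℝ ι} {k : Fin N} {τ : ℝ}
    (hτ : 0 < τ) (hN : 16 * τ ^ 2 ≤ N) (hfluct : fluctuation z k ≤ τ ^ 2) :
    (sampleCov z).PosDef := by
  have hN0 : (0 : ℝ) < N := lt_of_lt_of_le (by positivity) hN
  obtain ⟨hA, hy, -⟩ := norm_le_of_fluctuation_le hτ.le hN0 hfluct
  have hquarter := mul_inv_sqrt_le_quarter hN0 hN
  refine posDef_of_norm_sub_one_lt (isHermitian_sampleCov z) ?_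
  rw [sampleCov_eq_one_add (by exact_mod_cast hN0.ne'), add_sub_cancel_left]
  refine (norm_sub_le _ _).trans_lt ?_
  rw [norm_vecMulVec_ofLp]
  nlinarith [norm_nonneg (sampleMean z)]

end SampleStatistics

section ScoreExpansion

variable {m n : Type*} [Fintype m] [Fintype n] [DecidableEq m] [DecidableEq n] {N : ℕ}

local notation "dₘ" => (Fintype.card m : ℝ)
local notation "dₙ" => (Fintype.card n : ℝ)

lemma inv_mul_sum_scoreKernel (z : Fin N → EuclideanSpace ℝ (n × m))
    (x : EuclideanSpace ℝ (n × m)) :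
    (N : ℝ)⁻¹ * ∑ k, scoreKernel x (z k)
      = (meanCenteredOuter z * weight (unvec x)).trace + 2 * ⟪x, sampleMean z⟫ := by
  simp only [scoreKernel, meanCenteredOuter, sampleMean, Finset.sum_add_distrib, Matrix.smul_mul,
    Matrix.trace_smul, Matrix.sum_mul, Matrix.trace_sum, inner_smul_right, inner_sum,
    ← Finset.mul_sum, smul_eq_mul]
  ring

variable [Nonempty m] [Nonempty n]

lemma abs_scoreKernel_self_le {x : EuclideanSpace ℝ (n × m)} {τ : ℝ} (hx : ‖x‖ ≤ τ)
    (hτ : 1 ≤ τ) : |scoreKernel x x| ≤ 8 * dₘ * dₙ * τ ^ 4 := by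
  have hmn : 1 ≤ dₘ * dₙ := one_le_mul_of_one_le_of_one_le
    (by exact_mod_cast Fintype.card_pos) (by exact_mod_cast Fintype.card_pos)
  have hτ2 : 1 ≤ τ ^ 2 := one_le_pow₀ hτ
  have hx2 : ‖x‖ ^ 2 ≤ τ ^ 2 := by gcongr
  have houter : ‖centeredOuter x‖ ≤ 2 * (dₘ * dₙ) * τ ^ 2 := by
    have hone : ‖(1 : Matrix (n × m) (n × m) ℝ)‖ ≤ dₘ * dₙ :=
      norm_one_le_card.trans_eq (by rw [Fintype.card_prod, Nat.cast_mul, mul_comm])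
    have := norm_sub_le_of_le (norm_vecMulVec_ofLp x).le hone
    rw [← centeredOuter] at this
    nlinarith
  calc |scoreKernel x x| ≤ 2 * (dₘ * dₙ) * τ ^ 2 * (3 * τ ^ 2) + 2 * τ ^ 2 := by
        refine (abs_scoreKernel_le x x).trans ?_
        rw [← sq]
        gcongr
    _ ≤ 8 * dₘ * dₙ * τ ^ 4 := by
        have := mul_le_mul_of_nonneg_right hτ2 (sq_nonneg τ)
        nlinarith [mul_le_mul_of_nonneg_right hmn (by positivity : 0 ≤ τ ^ 4)]

lemma IsScalingPair.abs_trace_sub_add_sum_scoreKernel_le {z : Fin N → EuclideanSpace ℝ (n × m)}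
    {k : Fin N} {p : Matrix m m ℝ} {q : Matrix n n ℝ} {τ : ℝ}
    (h : IsScalingPair (sampleCov z) p q) (hτ : 1 ≤ τ) (hN : 16 * τ ^ 2 ≤ N)
    (hfluct : fluctuation z k ≤ τ ^ 2) :
    |(p * unvec (z k - sampleMean z) * q * (unvec (z k - sampleMean z))ᵀ).trace - ‖z k‖ ^ 2
        + (N : ℝ)⁻¹ * ∑ l ∈ Finset.univ.erase k, scoreKernel (z k) (z l)|
      ≤ 638 * dₘ ^ 3 * dₙ ^ 2 * τ ^ 4 / N := by
  have hN0 : (0 : ℝ) < N := lt_of_lt_of_le (by positivity) hN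
  obtain ⟨hA, hy, hx⟩ := norm_le_of_fluctuation_le (by positivity) hN0 hfluct
  have hη : (√N)⁻¹ ^ 2 = (N : ℝ)⁻¹ := by rw [inv_pow, Real.sq_sqrt hN0.le]
  rw [sampleCov_eq_one_add (by exact_mod_cast hN0.ne')] at h
  have hexpand := h.abs_trace_unvec_sub_le hA hy hx hτ
    (mul_inv_sqrt_le_quarter (by positivity) hN)
  rw [← inv_mul_sum_scoreKernel, hη, ← Finset.add_sum_erase _ _ (Finset.mem_univ k), mul_add,
    ← div_eq_mul_inv] at hexpand
  have hown : |(N : ℝ)⁻¹ * scoreKernel (z k) (z k)| ≤ 8 * dₘ ^ 3 * dₙ ^ 2 * τ ^ 4 / N := by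
    rw [abs_mul, abs_of_pos (inv_pos.2 hN0), inv_mul_eq_div]
    gcongr
    refine (abs_scoreKernel_self_le hx hτ).trans ?_
    gcongr
    · exact le_self_pow₀ (by exact_mod_cast Fintype.card_pos) (by norm_num)
    · exact le_self_pow₀ (by exact_mod_cast Fintype.card_pos) (by norm_num)
  have hsub := (abs_sub _ _).trans (add_le_add hexpand hown)
  rw [add_left_comm, add_sub_cancel_left] at hsub
  exact hsub.trans_eq (by ring)

end ScoreExpansion

section FluctuationMoments

variable {ι Ω : Type*} [Fintype ι] {N : ℕ} [MeasurableSpace Ω] {P : Measure Ω}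
  {z : Fin N → Ω → EuclideanSpace ℝ ι}

local notation "γ" => stdGaussian (EuclideanSpace ℝ ι)

lemma mul_sq_inv_mul (N : ℕ) (x : ℝ) : (N : ℝ) * ((N : ℝ)⁻¹ * x) ^ 2 = (N : ℝ)⁻¹ * x ^ 2 := by
  rcases eq_or_ne (N : ℝ) 0 with h | h
  · simp [h]
  · field_simp

lemma card_mul_norm_sampleMean_sq (z : Fin N → EuclideanSpace ℝ ι) :
    N * ‖sampleMean z‖ ^ 2 = ∑ i, (N : ℝ)⁻¹ * (∑ k, z k i) ^ 2 := by
  simp only [EuclideanSpace.real_norm_sq_eq, Finset.mul_sum, sampleMean, PiLp.smul_apply,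
    WithLp.ofLp_sum, Finset.sum_apply, smul_eq_mul]
  simp only [← Finset.mul_sum, mul_sq_inv_mul]

lemma integral_apply (i : ι) : ∫ x : EuclideanSpace ℝ ι, x i ∂γ = 0 := by
  classical
  simpa [EuclideanSpace.inner_single_left] using
    (hasLaw_inner_stdGaussian (EuclideanSpace.single i (1 : ℝ))).integral_eq

lemma inv_mul_integral_sq_sum [IsProbabilityMeasure P] (hz : ∀ k, HasLaw (z k) γ P)
    (hind : iIndepFun z P) (hN : N ≠ 0) {φ : EuclideanSpace ℝ ι → ℝ} (hφm : Measurable φ)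
    (hφ : MemLp φ 2 γ) (hφ0 : ∫ x, φ x ∂γ = 0) :
    ∫ ω, (N : ℝ)⁻¹ * (∑ k, φ (z k ω)) ^ 2 ∂P = ∫ x, φ x ^ 2 ∂γ := by
  rw [integral_const_mul, integral_sq_sum_of_iIndepFun hz hind hφm hφ hφ0, Finset.card_univ,
    Fintype.card_fin, inv_mul_cancel_left₀ (by exact_mod_cast hN)]

lemma integrable_inv_mul_sq_sum (hz : ∀ k, HasLaw (z k) γ P)
    {φ : EuclideanSpace ℝ ι → ℝ} (hφ : MemLp φ 2 γ) :
    Integrable (fun ω ↦ (N : ℝ)⁻¹ * (∑ k, φ (z k ω)) ^ 2) P :=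
  (memLp_finsetSum _ fun k _ ↦ memLp_comp_of_hasLaw (hz k) hφ).integrable_sq.const_mul _

lemma integrable_norm_sq_of_hasLaw {y : Ω → EuclideanSpace ℝ ι} (hy : HasLaw y γ P) :
    Integrable (fun ω ↦ ‖y ω‖ ^ 2) P := by
  simp only [EuclideanSpace.real_norm_sq_eq]
  exact integrable_finsetSum _ fun i _ ↦ (memLp_comp_of_hasLaw hy (memLp_apply i)).integrable_sq

lemma integral_norm_sq_of_hasLaw {y : Ω → EuclideanSpace ℝ ι} (hy : HasLaw y γ P) :
    ∫ ω, ‖y ω‖ ^ 2 ∂P = Fintype.card ι :=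
  (hy.integral_comp (f := fun x ↦ ‖x‖ ^ 2) (by fun_prop)).trans integral_norm_sq_stdGaussian

lemma integrable_mul_norm_sampleMean_sq (hz : ∀ k, HasLaw (z k) γ P) :
    Integrable (fun ω ↦ N * ‖sampleMean (z · ω)‖ ^ 2) P := by
  simp only [card_mul_norm_sampleMean_sq]
  exact integrable_finsetSum _ fun i _ ↦
    integrable_inv_mul_sq_sum hz (φ := fun x ↦ x i) (memLp_apply i)

lemma integral_mul_norm_sampleMean_sq [IsProbabilityMeasure P] (hz : ∀ k, HasLaw (z k) γ P)
    (hind : iIndepFun z P) (hN : N ≠ 0) :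
    ∫ ω, N * ‖sampleMean (z · ω)‖ ^ 2 ∂P = Fintype.card ι := by
  classical
  have hsq : ∀ i, ∫ x : EuclideanSpace ℝ ι, x i ^ 2 ∂γ = 1 := fun i ↦ by
    simp only [sq, integral_apply_mul_apply, Matrix.one_apply_eq]
  simp only [card_mul_norm_sampleMean_sq]
  rw [integral_finsetSum _ fun i _ ↦
    integrable_inv_mul_sq_sum hz (φ := fun x ↦ x i) (memLp_apply i)]
  simp only [fun i ↦ inv_mul_integral_sq_sum hz hind hN (by fun_prop) (memLp_apply i)
    (integral_apply i), hsq]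
  simp

variable [DecidableEq ι]

lemma card_mul_norm_meanCenteredOuter_sq (z : Fin N → EuclideanSpace ℝ ι) :
    N * ‖meanCenteredOuter z‖ ^ 2
      = ∑ i, ∑ j, (N : ℝ)⁻¹ * (∑ k, centeredOuter (z k) i j) ^ 2 := by
  simp only [frobenius_norm_sq, Finset.mul_sum, meanCenteredOuter, Matrix.smul_apply,
    Matrix.sum_apply, smul_eq_mul]
  simp only [← Finset.mul_sum, mul_sq_inv_mul]

lemma integrable_mul_norm_meanCenteredOuter_sq (hz : ∀ k, HasLaw (z k) γ P) :
    Integrable (fun ω ↦ N * ‖meanCenteredOuter (z · ω)‖ ^ 2) P := by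
  simp only [card_mul_norm_meanCenteredOuter_sq]
  exact integrable_finsetSum _ fun i _ ↦ integrable_finsetSum _ fun j _ ↦
    integrable_inv_mul_sq_sum hz
      (φ := fun x ↦ centeredOuter x i j) (memLp_centeredOuter_apply i j)

lemma integrable_fluctuation (hz : ∀ k, HasLaw (z k) γ P) (k : Fin N) :
    Integrable (fun ω ↦ fluctuation (z · ω) k) P :=
  ((integrable_mul_norm_meanCenteredOuter_sq hz).add
    (integrable_mul_norm_sampleMean_sq hz)).add (integrable_norm_sq_of_hasLaw (hz k))

variable [IsProbabilityMeasure P]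

lemma integral_mul_norm_meanCenteredOuter_sq (hz : ∀ k, HasLaw (z k) γ P) (hind : iIndepFun z P)
    (hN : N ≠ 0) :
    ∫ ω, N * ‖meanCenteredOuter (z · ω)‖ ^ 2 ∂P
      = (Fintype.card ι : ℝ) ^ 2 + Fintype.card ι := by
  have hsq : ∀ i j, ∫ x, centeredOuter x i j ^ 2 ∂γ = 1 + (1 : Matrix ι ι ℝ) i j := by
    intro i j
    simp only [sq, integral_centeredOuter_mul, Matrix.one_apply_eq, mul_one]
    by_cases h : i = j <;> simp [Matrix.one_apply, h, eq_comm]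
  simp only [card_mul_norm_meanCenteredOuter_sq]
  rw [integral_sum_sum fun i j ↦ integrable_inv_mul_sq_sum hz
      (φ := fun x ↦ centeredOuter x i j) (memLp_centeredOuter_apply i j)]
  simp only [inv_mul_integral_sq_sum hz hind hN (measurable_centeredOuter_apply _ _)
      (memLp_centeredOuter_apply _ _) (integral_centeredOuter_apply _ _), hsq]
  simp [Finset.sum_add_distrib, Matrix.one_apply, sq]

lemma integral_fluctuation (hz : ∀ k, HasLaw (z k) γ P) (hind : iIndepFun z P) (k : Fin N) :
    ∫ ω, fluctuation (z · ω) k ∂P = (Fintype.card ι : ℝ) ^ 2 + 3 * Fintype.card ι := by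
  have houter := integrable_mul_norm_meanCenteredOuter_sq hz
  have hmean := integrable_mul_norm_sampleMean_sq hz
  have hsum : Integrable (fun ω ↦ N * ‖meanCenteredOuter (z · ω)‖ ^ 2
      + N * ‖sampleMean (z · ω)‖ ^ 2) P := houter.add hmean
  simp only [fluctuation]
  rw [integral_add hsum (integrable_norm_sq_of_hasLaw (hz k)),
    integral_add houter hmean, integral_mul_norm_meanCenteredOuter_sq hz hind k.pos.ne',
    integral_mul_norm_sampleMean_sq hz hind k.pos.ne', integral_norm_sq_of_hasLaw (hz k)]
  ring

lemma measure_lt_fluctuation_le (hz : ∀ k, HasLaw (z k) γ P) (hind : iIndepFun z P) (k : Fin N)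
    {t : ℝ} (ht : 0 < t) :
    P {ω | t < fluctuation (z · ω) k}
      ≤ ENNReal.ofReal (((Fintype.card ι : ℝ) ^ 2 + 3 * Fintype.card ι) / t) :=
  integral_fluctuation hz hind k ▸ measure_lt_le_ofReal_integral_div (integrable_fluctuation hz k)
    (fun _ ↦ fluctuation_nonneg _ k) ht

end FluctuationMoments

section Concentration

variable {m n Ω : Type*} [Fintype m] [Fintype n] [DecidableEq m] [DecidableEq n]
  [Nonempty m] [Nonempty n] {N : ℕ} [MeasurableSpace Ω] {P : Measure Ω} [IsProbabilityMeasure P]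
  {z : Fin N → Ω → EuclideanSpace ℝ (n × m)}

local notation "dₘ" => (Fintype.card m : ℝ)
local notation "dₙ" => (Fintype.card n : ℝ)

lemma measure_lt_sum_scoreKernel_sq_le {K : ℝ} (hK : 0 < K)
    (hz : ∀ k, HasLaw (z k) (stdGaussian (EuclideanSpace ℝ (n × m))) P) (hind : iIndepFun z P)
    (k : Fin N) :
    P {ω | (K * (dₘ + dₙ)) ^ 2 * N
        < (∑ l ∈ Finset.univ.erase k, scoreKernel (z k ω) (z l ω)) ^ 2}
      ≤ ENNReal.ofReal (30 / K ^ 2) := by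
  have hN : (0 : ℝ) < N := by exact_mod_cast k.pos
  have hk := Finset.notMem_erase k Finset.univ
  have : 0 < dₘ := by exact_mod_cast Fintype.card_pos
  refine (measure_lt_le_ofReal_integral_div (memLp_sum_kernel hz hind memLp_scoreKernel
    hk).integrable_sq (fun ω ↦ sq_nonneg _) (by positivity)).trans (ENNReal.ofReal_le_ofReal ?_)
  rw [integral_sq_sum_kernel hz hind measurable_scoreKernel memLp_scoreKernel integral_scoreKernel
    hk, div_le_iff₀ (by positivity)]
  have hcard : ((Finset.univ.erase k).card : ℝ) ≤ N := by
    exact_mod_cast (Finset.card_le_univ _).trans_eq (Fintype.card_fin N)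
  calc _ ≤ N * (30 * (dₘ + dₙ) ^ 2) := by
        gcongr
        exact integral_sq_scoreKernel_le
    _ = _ := by field_simp

end Concentration

section ScalingPairConcentration

variable {m n : Type*} [Fintype m] [Fintype n] [DecidableEq m] [DecidableEq n]
  [Nonempty m] [Nonempty n] {N : ℕ}

local notation "dₘ" => (Fintype.card m : ℝ)
local notation "dₙ" => (Fintype.card n : ℝ)

/-- Scaling pairs of the empirical covariance of the sample `z` exist, and for each of them the
flip-flop distance of `z k` to the sample mean is within `δ` of `‖z k‖ ^ 2`. -/
def IsDistanceStable (z : Fin N → EuclideanSpace ℝ (n × m)) (k : Fin N) (δ : ℝ) : Prop :=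
  (∃ p q, IsScalingPair (sampleCov z) p q) ∧ ∀ p q, IsScalingPair (sampleCov z) p q →
    |(p * unvec (z k - sampleMean z) * q * (unvec (z k - sampleMean z))ᵀ).trace - ‖z k‖ ^ 2| ≤ δ

lemma isDistanceStable_of_fluctuation_le {z : Fin N → EuclideanSpace ℝ (n × m)} {k : Fin N}
    {τ δ : ℝ} (hτ : 1 ≤ τ) (hN : 16 * τ ^ 2 ≤ N) (hfluct : fluctuation z k ≤ τ ^ 2)
    (hrem : 638 * dₘ ^ 3 * dₙ ^ 2 * τ ^ 4 / N ≤ δ / 2)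
    (hsum : |(N : ℝ)⁻¹ * ∑ l ∈ Finset.univ.erase k, scoreKernel (z k) (z l)| ≤ δ / 2) :
    IsDistanceStable z k δ := by
  refine ⟨exists_isScalingPair ?_, fun p q h ↦ ?_⟩
  · exact posDef_sampleCov_of_fluctuation_le (by positivity) hN hfluct
  · have hexpand := (h.abs_trace_sub_add_sum_scoreKernel_le hτ hN hfluct).trans hrem
    have hsub := (abs_sub _ _).trans (add_le_add hexpand hsum)
    rwa [add_sub_cancel_right, add_halves] at hsub

lemma measure_not_isDistanceStable_le {Ω : Type*} [MeasurableSpace Ω] {P : Measure Ω}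
    [IsProbabilityMeasure P] {z : Fin N → Ω → EuclideanSpace ℝ (n × m)} {ε K τ : ℝ}
    (hz : ∀ k, HasLaw (z k) (stdGaussian (EuclideanSpace ℝ (n × m))) P) (hind : iIndepFun z P)
    (k : Fin N) (hK : 0 < K) (hKε : 30 / (K / 2) ^ 2 ≤ ε / 2) (hτ : 1 ≤ τ) (hN : 16 * τ ^ 2 ≤ N)
    (hτε : ((Fintype.card (n × m) : ℝ) ^ 2 + 3 * Fintype.card (n × m)) / τ ^ 2 ≤ ε / 2)
    (hrem : 638 * dₘ ^ 3 * dₙ ^ 2 * τ ^ 4 / N ≤ K * ((dₘ + dₙ) / √N) / 2) :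
    P {ω | ¬ IsDistanceStable (z · ω) k (K * ((dₘ + dₙ) / √N))} ≤ ENNReal.ofReal ε := by
  have hN' : (0 : ℝ) < N := by exact_mod_cast k.pos
  have hε : 0 ≤ ε / 2 := le_trans (by positivity) hKε
  have hcover : {ω | ¬ IsDistanceStable (z · ω) k (K * ((dₘ + dₙ) / √N))}
      ⊆ {ω | τ ^ 2 < fluctuation (z · ω) k} ∪ {ω | (K / 2 * (dₘ + dₙ)) ^ 2 * N
        < (∑ l ∈ Finset.univ.erase k, scoreKernel (z k ω) (z l ω)) ^ 2} := by
    intro ω hω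
    by_contra! hgood
    simp only [Set.mem_union, Set.mem_ofPred_eq, not_or, not_lt] at hgood
    refine hω (isDistanceStable_of_fluctuation_le hτ hN hgood.1 hrem ?_)
    have hsum := Real.abs_le_sqrt hgood.2
    rw [Real.sqrt_mul (by positivity), Real.sqrt_sq (by positivity)] at hsum
    rw [abs_mul, abs_of_pos (inv_pos.2 hN')]
    calc _ ≤ (N : ℝ)⁻¹ * (K / 2 * (dₘ + dₙ) * √N) := by gcongr
      _ = K * ((dₘ + dₙ) / √N) / 2 := by
        rw [inv_mul_eq_div, mul_div_assoc, Real.sqrt_div_self]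
        ring
  calc _ ≤ _ := (measure_mono hcover).trans (measure_union_le _ _)
    _ ≤ ENNReal.ofReal (ε / 2) + ENNReal.ofReal (ε / 2) := add_le_add
        ((measure_lt_fluctuation_le hz hind k (by positivity)).trans
          (ENNReal.ofReal_le_ofReal hτε))
        ((measure_lt_sum_scoreKernel_sq_le (by positivity) hz hind k).trans
          (ENNReal.ofReal_le_ofReal hKε))
    _ = ENNReal.ofReal ε := by rw [← ENNReal.ofReal_add hε hε, add_halves]

variable (m n) in
theorem exists_forall_measure_not_isDistanceStable_le {ε K : ℝ} (hε : 0 < ε) (hK : 0 < K)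
    (hεK : 240 ≤ ε * K ^ 2) :
    ∃ N₀ : ℕ, ∀ N ≥ N₀, ∀ (Ω : Type*) [MeasurableSpace Ω] (P : Measure Ω) [IsProbabilityMeasure P]
      (z : Fin N → Ω → EuclideanSpace ℝ (n × m)),
      (∀ k, HasLaw (z k) (stdGaussian (EuclideanSpace ℝ (n × m))) P) → iIndepFun z P →
      ∀ k, P {ω | ¬ IsDistanceStable (z · ω) k (K * ((dₘ + dₙ) / √N))} ≤ ENNReal.ofReal ε := by
  set d : ℝ := (Fintype.card (n × m) : ℝ) ^ 2 + 3 * Fintype.card (n × m)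
  set τ : ℝ := max 1 √(2 * d / ε)
  set C : ℝ := 638 * dₘ ^ 3 * dₙ ^ 2 * τ ^ 4
  have hτ : 1 ≤ τ := le_max_left _ _
  have hτε : d / τ ^ 2 ≤ ε / 2 := by
    have hτd := (Real.sqrt_le_left (by positivity)).1 (le_max_right 1 √(2 * d / ε))
    rw [div_le_iff₀ (by positivity)] at hτd ⊢
    linarith
  have hKε : 30 / (K / 2) ^ 2 ≤ ε / 2 := by
    rw [div_le_iff₀ (by positivity)]
    linarith
  have hs : 0 < K * (dₘ + dₙ) / 2 := by
    have : 0 < dₘ := by exact_mod_cast Fintype.card_pos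
    positivity
  obtain ⟨N₀, hN₀⟩ := exists_nat_ge (max (16 * τ ^ 2) ((C / (K * (dₘ + dₙ) / 2)) ^ 2))
  refine ⟨N₀, fun N hN Ω _ P _ z hz hind k ↦
    measure_not_isDistanceStable_le hz hind k hK hKε hτ ?_ hτε ?_⟩
  · exact (le_max_left _ _).trans (hN₀.trans (by exact_mod_cast hN))
  · have hN' : (0 : ℝ) < N := by exact_mod_cast k.pos
    have hsqrt := (div_le_iff₀ hs).1 (Real.le_sqrt_of_sq_le
      ((le_max_right _ _).trans (hN₀.trans (Nat.cast_le.2 hN))))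
    calc C / N ≤ √N * (K * (dₘ + dₙ) / 2) / N := by gcongr
      _ = K * ((dₘ + dₙ) / √N) / 2 := by
        rw [mul_comm, mul_div_assoc, Real.sqrt_div_self]
        ring

end ScalingPairConcentration

section Whitening

open scoped MatrixOrder

lemma hasLaw_inv_toEuclideanCLM_sub {ι : Type*} [Fintype ι] [DecidableEq ι] {B : Matrix ι ι ℝ}
    (hB : B.PosDef) (μ : EuclideanSpace ℝ ι) :
    HasLaw (fun x ↦ Matrix.toEuclideanCLM (𝕜 := ℝ) B⁻¹ (x - μ))
      (stdGaussian (EuclideanSpace ℝ ι)) (multivariateGaussian μ (B * B)) := by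
  refine ⟨by fun_prop, ?_⟩
  rw [multivariateGaussian, CFC.sqrt_unique rfl (Matrix.nonneg_iff_posSemidef.2 hB.posSemidef),
    Measure.map_map (by fun_prop) (by fun_prop)]
  convert Measure.map_id using 2
  ext1 x
  simp [← mul_apply_eq_comp, ← map_mul,
    Matrix.nonsing_inv_mul _ ((Matrix.isUnit_iff_isUnit_det _).1 hB.isUnit)]

lemma exists_posDef_mul_self_eq {ι : Type*} [Fintype ι] {S : Matrix ι ι ℝ} (hS : S.PosDef) :
    ∃ L : Matrix ι ι ℝ, L.PosDef ∧ L * L = S := by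
  classical
  have h : CFC.sqrt S * CFC.sqrt S = S :=
    CFC.sqrt_mul_sqrt_self S (Matrix.nonneg_iff_posSemidef.2 hS.posSemidef)
  have hu : IsUnit (CFC.sqrt S) := isUnit_of_mul_isUnit_left (h ▸ hS.isUnit)
  exact ⟨_, (Matrix.nonneg_iff_posSemidef.1 (CFC.sqrt_nonneg S)).posDef_iff_isUnit.2 hu, h⟩

variable {Ω : Type*} [MeasurableSpace Ω] {P : Measure Ω} {c r N : ℕ}
  {X : Fin N → Ω → Matrix (Fin c) (Fin r) ℝ} {M : Matrix (Fin c) (Fin r) ℝ}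
  {Sc : Matrix (Fin c) (Fin c) ℝ} {Sr : Matrix (Fin r) (Fin r) ℝ}

theorem IsSample.exists_whitening (h : IsSample P X M Sc Sr) (hSc : Sc.PosDef) (hSr : Sr.PosDef) :
    ∃ (L : Matrix (Fin c) (Fin c) ℝ) (R : Matrix (Fin r) (Fin r) ℝ)
      (z : Fin N → Ω → EuclideanSpace ℝ (Fin r × Fin c)),
      IsUnit L ∧ IsUnit R ∧ L * Lᵀ = Sc ∧ R * Rᵀ = Sr ∧
      (∀ k ω, X k ω = M + L * unvec (z k ω) * Rᵀ) ∧
      (∀ k, HasLaw (z k) (stdGaussian (EuclideanSpace ℝ (Fin r × Fin c))) P) ∧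
      iIndepFun z P := by
  obtain ⟨L, hL, rfl⟩ := exists_posDef_mul_self_eq hSc
  obtain ⟨R, hR, rfl⟩ := exists_posDef_mul_self_eq hSr
  have hB := hR.kronecker hL
  have hcov : (R * R) ⊗ₖ (L * L) = R ⊗ₖ L * R ⊗ₖ L := Matrix.mul_kronecker_mul ..
  let w (x : EuclideanSpace ℝ (Fin r × Fin c)) : EuclideanSpace ℝ (Fin r × Fin c) :=
    Matrix.toEuclideanCLM (𝕜 := ℝ) (R ⊗ₖ L)⁻¹ (x - WithLp.toLp 2 M.vec)
  have hw : ∀ x, R ⊗ₖ L *ᵥ w x = x - M.vec := fun x ↦ by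
    simp [w, ← Matrix.mulVec_sub,
      Matrix.mul_nonsing_inv _ ((Matrix.isUnit_iff_isUnit_det _).1 hB.isUnit)]
  refine ⟨L, R, fun k ω ↦ w (WithLp.toLp 2 (X k ω).vec), hL.isUnit, hR.isUnit,
    congrArg (L * ·) hL.isHermitian, congrArg (R * ·) hR.isHermitian, fun k ω ↦ ?_, fun k ↦ ?_,
    h.indep.comp (fun _ ↦ w) fun _ ↦ by fun_prop⟩
  · have hvec := hw (WithLp.toLp 2 (X k ω).vec)
    rw [← Matrix.vec_inj, Matrix.vec_add, ← Matrix.kronecker_mulVec_vec]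
    exact (add_eq_of_eq_sub' hvec).symm
  · exact (hcov ▸ hasLaw_inv_toEuclideanCLM_sub hB _).comp (h.hasLaw k)

end Whitening

section Affine

variable {c r N : ℕ} {X : Fin N → Matrix (Fin c) (Fin r) ℝ}
  {z : Fin N → EuclideanSpace ℝ (Fin r × Fin c)} {M : Matrix (Fin c) (Fin r) ℝ}
  {L : Matrix (Fin c) (Fin c) ℝ} {R : Matrix (Fin r) (Fin r) ℝ}

lemma unvec_sampleMean {m n : Type*} (z : Fin N → EuclideanSpace ℝ (n × m)) :
    unvec (sampleMean z) = (N : ℝ)⁻¹ • ∑ k, unvec (z k) := by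
  ext i j
  simp [unvec, sampleMean, Matrix.sum_apply]

lemma sub_matMean_eq (hX : ∀ k, X k = M + L * unvec (z k) * Rᵀ) (k : Fin N) :
    X k - matMean X = L * unvec (z k - sampleMean z) * Rᵀ := by
  have hN : (N : ℝ) ≠ 0 := by exact_mod_cast k.pos.ne'
  have hmean : matMean X = M + L * unvec (sampleMean z) * Rᵀ := by
    simp only [matMean, hX, Finset.sum_add_distrib, smul_add, unvec_sampleMean, Matrix.mul_smul,
      Matrix.smul_mul, Matrix.mul_sum, Matrix.sum_mul]
    simp [← Nat.cast_smul_eq_nsmul ℝ, smul_smul, hN]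
  rw [hmean, hX, add_sub_add_left_eq_sub, unvec_sub, Matrix.mul_sub, Matrix.sub_mul]

lemma matMSD_eq_trace {X : Matrix (Fin c) (Fin r) ℝ} {W : Matrix (Fin c) (Fin r) ℝ}
    (hX : X - M = L * W * Rᵀ) (Sc : Matrix (Fin c) (Fin c) ℝ) (Sr : Matrix (Fin r) (Fin r) ℝ) :
    matMSD X M Sc Sr = (Lᵀ * Sc⁻¹ * L * W * (Rᵀ * Sr⁻¹ * R) * Wᵀ).trace := by
  rw [matMSD, hX, Matrix.transpose_mul, Matrix.transpose_mul, Matrix.transpose_transpose,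
    ← Matrix.mul_assoc, ← Matrix.mul_assoc, Matrix.trace_mul_comm]
  simp only [Matrix.mul_assoc]

lemma transpose_mul_inv_conj_mul {ι : Type*} [Fintype ι] [DecidableEq ι] {L : Matrix ι ι ℝ}
    (hL : IsUnit L) (A : Matrix ι ι ℝ) : Lᵀ * (L * A * Lᵀ)⁻¹ * L = A⁻¹ := by
  have hdet := (Matrix.isUnit_iff_isUnit_det L).1 hL
  rw [Matrix.mul_inv_rev, Matrix.mul_inv_rev, ← Matrix.mul_assoc,
    Matrix.mul_nonsing_inv _ (Matrix.isUnit_det_transpose L hdet), Matrix.one_mul,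
    Matrix.mul_assoc, Matrix.nonsing_inv_mul _ hdet, Matrix.mul_one]

lemma matMSD_eq_norm_sq (hL : IsUnit L) (hR : IsUnit R) {X : Matrix (Fin c) (Fin r) ℝ}
    {z : EuclideanSpace ℝ (Fin r × Fin c)} (hX : X = M + L * unvec z * Rᵀ) :
    matMSD X M (L * Lᵀ) (R * Rᵀ) = ‖z‖ ^ 2 := by
  have hLw := transpose_mul_inv_conj_mul hL 1
  have hRw := transpose_mul_inv_conj_mul hR 1
  rw [Matrix.mul_one, inv_one] at hLw hRw
  rw [matMSD_eq_trace (sub_eq_of_eq_add' hX), hLw, hRw, Matrix.one_mul, Matrix.mul_one,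
    trace_mul_transpose_self, norm_unvec]

lemma contract_vecMulVec {m n : Type*} [Fintype n] (x : EuclideanSpace ℝ (n × m))
    (q : Matrix n n ℝ) : contract (Matrix.vecMulVec x x) q = unvec x * qᵀ * (unvec x)ᵀ := by
  ext i i'
  simp only [contract_apply, Matrix.mul_apply, Matrix.vecMulVec_apply, Matrix.transpose_apply,
    unvec, Matrix.of_apply, Finset.sum_mul]
  rw [Finset.sum_comm]
  simp only [mul_right_comm]

lemma contract_swapFactors_vecMulVec {m n : Type*} [Fintype m] (x : EuclideanSpace ℝ (n × m))
    (p : Matrix m m ℝ) :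
    contract (swapFactors (Matrix.vecMulVec x x)) p = (unvec x)ᵀ * pᵀ * unvec x :=
  contract_vecMulVec (WithLp.toLp 2 fun a ↦ x a.swap) p

lemma flipC_eq (hX : ∀ k, X k = M + L * unvec (z k) * Rᵀ) {Sr : Matrix (Fin r) (Fin r) ℝ}
    (hSr : Sr.IsSymm) :
    flipC X Sr = (r : ℝ)⁻¹ • (L * contract (sampleCov z) (Rᵀ * Sr⁻¹ * R) * Lᵀ) := by
  simp only [flipC, sub_matMean_eq hX, sampleCov, map_smul, map_sum, LinearMap.smul_apply,
    LinearMap.sum_apply, contract_vecMulVec, Matrix.mul_smul, Matrix.smul_mul, Matrix.mul_sum,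
    Matrix.sum_mul, smul_smul, mul_inv_rev, Matrix.transpose_mul, Matrix.transpose_transpose,
    Matrix.transpose_nonsing_inv, hSr.eq, Matrix.mul_assoc]

lemma flipR_eq (hX : ∀ k, X k = M + L * unvec (z k) * Rᵀ) {Sc : Matrix (Fin c) (Fin c) ℝ}
    (hSc : Sc.IsSymm) :
    flipR X Sc
      = (c : ℝ)⁻¹ • (R * contract (swapFactors (sampleCov z)) (Lᵀ * Sc⁻¹ * L) * Rᵀ) := by
  simp only [flipR, sub_matMean_eq hX, sampleCov, map_smul, map_sum, LinearMap.smul_apply,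
    LinearMap.sum_apply, contract_swapFactors_vecMulVec, Matrix.mul_smul, Matrix.smul_mul,
    Matrix.mul_sum, Matrix.sum_mul, smul_smul, mul_inv_rev, Matrix.transpose_mul,
    Matrix.transpose_transpose, Matrix.transpose_nonsing_inv, hSc.eq, Matrix.mul_assoc]

lemma posDef_transpose_mul_inv_mul_iff {ι : Type*} [Fintype ι] [DecidableEq ι] {L : Matrix ι ι ℝ}
    (hL : IsUnit L) {A : Matrix ι ι ℝ} : (Lᵀ * A⁻¹ * L).PosDef ↔ A.PosDef := by
  rw [← Matrix.conjTranspose_eq_transpose_of_trivial, ← Matrix.star_eq_conjTranspose,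
    Matrix.IsUnit.posDef_star_left_conjugate_iff hL, Matrix.posDef_inv_iff]

lemma eq_inv_smul_conj_iff {ι : Type*} [Fintype ι] [DecidableEq ι] {L A C : Matrix ι ι ℝ}
    (hL : IsUnit L) (hA : IsUnit A) {a : ℝ} (ha : a ≠ 0) :
    A = a⁻¹ • (L * C * Lᵀ) ↔ a • (Lᵀ * A⁻¹ * L)⁻¹ = C := by
  have hconj : L * (Lᵀ * A⁻¹ * L)⁻¹ * Lᵀ = A := by
    have h := transpose_mul_inv_conj_mul ((Matrix.isUnit_transpose L).2 hL) A⁻¹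
    rwa [Matrix.transpose_transpose,
      Matrix.nonsing_inv_nonsing_inv _ ((Matrix.isUnit_iff_isUnit_det A).1 hA)] at h
  rw [eq_inv_smul_iff₀ ha]
  nth_rw 1 [← hconj]
  rw [← Matrix.smul_mul, ← Matrix.mul_smul,
    ((Matrix.isUnit_transpose L).2 hL).mul_left_inj, hL.mul_right_inj]

lemma isFlipFlopMLE_iff (hL : IsUnit L) (hR : IsUnit R) (hc : c ≠ 0) (hr : r ≠ 0)
    (hX : ∀ k, X k = M + L * unvec (z k) * Rᵀ) {Sc : Matrix (Fin c) (Fin c) ℝ}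
    {Sr : Matrix (Fin r) (Fin r) ℝ} :
    IsFlipFlopMLE X Sc Sr
      ↔ IsScalingPair (sampleCov z) (Lᵀ * Sc⁻¹ * L) (Rᵀ * Sr⁻¹ * R) := by
  have hc' : (c : ℝ) ≠ 0 := Nat.cast_ne_zero.2 hc
  have hr' : (r : ℝ) ≠ 0 := Nat.cast_ne_zero.2 hr
  have heq (hSc : Sc.PosDef) (hSr : Sr.PosDef) :
      (Sc = flipC X Sr ∧ Sr = flipR X Sc) ↔
        (r : ℝ) • (Lᵀ * Sc⁻¹ * L)⁻¹ = contract (sampleCov z) (Rᵀ * Sr⁻¹ * R) ∧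
        (c : ℝ) • (Rᵀ * Sr⁻¹ * R)⁻¹ = contract (swapFactors (sampleCov z)) (Lᵀ * Sc⁻¹ * L) := by
    rw [flipC_eq hX (Matrix.isHermitian_iff_isSymm.1 hSr.isHermitian),
      flipR_eq hX (Matrix.isHermitian_iff_isSymm.1 hSc.isHermitian),
      eq_inv_smul_conj_iff hL hSc.isUnit hr', eq_inv_smul_conj_iff hR hSr.isUnit hc']
  have hposc := posDef_transpose_mul_inv_mul_iff (A := Sc) hL
  have hposr := posDef_transpose_mul_inv_mul_iff (A := Sr) hR
  refine ⟨fun ⟨hSc, hSr, hCol, hRow⟩ ↦ ?_, fun ⟨hp, hq, hCol, hRow⟩ ↦ ?_⟩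
  · obtain ⟨hleft, hright⟩ := (heq hSc hSr).1 ⟨hCol, hRow⟩
    exact ⟨hposc.2 hSc, hposr.2 hSr, by rwa [Fintype.card_fin], by rwa [Fintype.card_fin]⟩
  · rw [Fintype.card_fin] at hCol hRow
    obtain ⟨hleft, hright⟩ := (heq (hposc.1 hp) (hposr.1 hq)).2 ⟨hCol, hRow⟩
    exact ⟨hposc.1 hp, hposr.1 hq, hleft, hright⟩

lemma IsDistanceStable.isFlipFlopMLE {k : Fin N} {δ : ℝ} (h : IsDistanceStable z k δ)
    (hL : IsUnit L) (hR : IsUnit R) (hc : c ≠ 0) (hr : r ≠ 0)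
    (hX : ∀ k, X k = M + L * unvec (z k) * Rᵀ) :
    (∃ Sc Sr, IsFlipFlopMLE X Sc Sr) ∧ ∀ Sc Sr, IsFlipFlopMLE X Sc Sr →
      |matMSD (X k) (matMean X) Sc Sr - matMSD (X k) M (L * Lᵀ) (R * Rᵀ)| ≤ δ := by
  obtain ⟨⟨p, q, hpq⟩, hstable⟩ := h
  refine ⟨⟨L * p⁻¹ * Lᵀ, R * q⁻¹ * Rᵀ, (isFlipFlopMLE_iff hL hR hc hr hX).2 ?_⟩,
    fun Sc Sr h ↦ ?_⟩
  · have hp := (Matrix.isUnit_iff_isUnit_det p).1 hpq.posDef_left.isUnit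
    have hq := (Matrix.isUnit_iff_isUnit_det q).1 hpq.posDef_right.isUnit
    rwa [transpose_mul_inv_conj_mul hL, transpose_mul_inv_conj_mul hR,
      Matrix.nonsing_inv_nonsing_inv _ hp, Matrix.nonsing_inv_nonsing_inv _ hq]
  · rw [matMSD_eq_trace (sub_matMean_eq hX k), matMSD_eq_norm_sq hL hR (hX k)]
    exact hstable _ _ ((isFlipFlopMLE_iff hL hR hc hr hX).1 h)

end Affine

section OneColumn

variable {ι : Type*} {N : ℕ} {z : Fin N → EuclideanSpace ℝ ι}

lemma contract_submatrix_snd (S : Matrix ι ι ℝ) (q : Matrix Unit Unit ℝ) :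
    contract (S.submatrix (Prod.snd : Unit × ι → ι) Prod.snd) q = q () () • S := by
  ext i i'
  simp [contract_apply, mul_comm]

variable [Fintype ι]

lemma contract_swapFactors_submatrix_snd (S p : Matrix ι ι ℝ) :
    contract (swapFactors (S.submatrix (Prod.snd : Unit × ι → ι) Prod.snd)) p
      = Matrix.of fun _ _ ↦ (S * p).trace := by
  ext i i'
  simp [contract_apply, swapFactors, Matrix.trace, Matrix.mul_apply]

/-- A vector regarded as a matrix with one column, in vectorized form. -/
def asColumn : EuclideanSpace ℝ ι ≃ₗᵢ[ℝ] EuclideanSpace ℝ (Unit × ι) :=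
  LinearIsometryEquiv.piLpCongrLeft 2 ℝ ℝ (Equiv.punitProd ι).symm

lemma unvec_asColumn (x : EuclideanSpace ℝ ι) :
    unvec (asColumn x) = Matrix.replicateCol Unit x := by
  ext i j
  simp [unvec, asColumn]

lemma sampleMean_asColumn : sampleMean (fun k ↦ asColumn (z k)) = asColumn (sampleMean z) := by
  simp only [sampleMean, map_smul, map_sum]

lemma sampleCov_asColumn :
    sampleCov (fun k ↦ asColumn (z k)) = (sampleCov z).submatrix Prod.snd Prod.snd := by
  ext a b
  rw [sampleCov, sampleMean_asColumn]
  simp [sampleCov, Matrix.sum_apply, Matrix.vecMulVec_apply, asColumn]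

variable [DecidableEq ι]

lemma isScalingPair_inv_one {S : Matrix ι ι ℝ} (hS : S.PosDef) :
    IsScalingPair (S.submatrix (Prod.snd : Unit × ι → ι) Prod.snd) S⁻¹ 1 where
  posDef_left := hS.inv
  posDef_right := .one
  card_smul_inv_left := by
    simp [contract_submatrix_snd,
      Matrix.nonsing_inv_nonsing_inv _ ((Matrix.isUnit_iff_isUnit_det S).1 hS.isUnit)]
  card_smul_inv_right := by
    rw [contract_swapFactors_submatrix_snd,
      Matrix.mul_nonsing_inv _ ((Matrix.isUnit_iff_isUnit_det S).1 hS.isUnit)]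
    ext i j
    simp

lemma IsScalingPair.posDef_of_submatrix_snd {S p : Matrix ι ι ℝ} {q : Matrix Unit Unit ℝ}
    (h : IsScalingPair (S.submatrix Prod.snd Prod.snd) p q) : S.PosDef := by
  have hq : 0 < q () () := h.posDef_right.diag_pos
  have hS : p⁻¹ = q () () • S := by
    simpa [contract_submatrix_snd] using h.card_smul_inv_left
  rw [← inv_smul_smul₀ hq.ne' S, ← hS]
  exact h.posDef_left.inv.smul (inv_pos.2 hq)

lemma IsDistanceStable.posDef_sampleCov {k : Fin N} {δ : ℝ}
    (h : IsDistanceStable (fun k ↦ asColumn (z k)) k δ) : (sampleCov z).PosDef := by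
  obtain ⟨⟨p, q, hpq⟩, -⟩ := h
  rw [sampleCov_asColumn] at hpq
  exact hpq.posDef_of_submatrix_snd

lemma IsDistanceStable.abs_dotProduct_sub_le {k : Fin N} {δ : ℝ}
    (h : IsDistanceStable (fun k ↦ asColumn (z k)) k δ) :
    |(z k - sampleMean z).ofLp ⬝ᵥ ((sampleCov z)⁻¹ *ᵥ (z k - sampleMean z).ofLp) - ‖z k‖ ^ 2|
      ≤ δ := by
  have hle := h.2 _ _ (sampleCov_asColumn (z := z) ▸ isScalingPair_inv_one h.posDef_sampleCov)
  rw [sampleMean_asColumn, ← map_sub, unvec_asColumn, LinearIsometryEquiv.norm_map,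
    Matrix.mul_one] at hle
  convert hle using 3
  rw [← Matrix.replicateCol_mulVec, Matrix.trace_mul_comm]
  simp [Matrix.trace, Matrix.mul_apply, dotProduct]

end OneColumn

section VectorAffine

variable {ι : Type*} [Fintype ι] {N : ℕ} {x : Fin N → ι → ℝ} {z : Fin N → EuclideanSpace ℝ ι}
  {μ : ι → ℝ} {B : Matrix ι ι ℝ}

lemma sub_vecMean_eq (hx : ∀ k, x k = μ + B *ᵥ z k) (k : Fin N) :
    x k - vecMean x = B *ᵥ (z k - sampleMean z).ofLp := by
  have hN : (N : ℝ) ≠ 0 := by exact_mod_cast k.pos.ne'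
  have hmean : vecMean x = μ + B *ᵥ sampleMean z := by
    simp only [vecMean, hx, Finset.sum_add_distrib, smul_add, sampleMean, WithLp.ofLp_smul,
      WithLp.ofLp_sum, Matrix.mulVec_smul, Matrix.mulVec_sum]
    simp [← Nat.cast_smul_eq_nsmul ℝ, smul_smul, hN]
  rw [hmean, hx, add_sub_add_left_eq_sub, ← Matrix.mulVec_sub, WithLp.ofLp_sub]

lemma vecCov_eq (hx : ∀ k, x k = μ + B *ᵥ z k) (hN : N ≠ 0) :
    vecCov x = (1 - (N : ℝ)⁻¹)⁻¹ • (B * sampleCov z * Bᵀ) := by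
  have hN' : (N : ℝ) ≠ 0 := Nat.cast_ne_zero.2 hN
  have hscale : ((N : ℝ) - 1)⁻¹ = (1 - (N : ℝ)⁻¹)⁻¹ * (N : ℝ)⁻¹ := by
    rw [← mul_inv, sub_mul, one_mul, inv_mul_cancel₀ hN']
  simp only [vecCov, sub_vecMean_eq hx, sampleCov, hscale, Matrix.mul_smul, Matrix.smul_mul,
    Matrix.mul_sum, Matrix.sum_mul, Matrix.mul_vecMulVec, Matrix.vecMulVec_mul,
    Matrix.vecMul_transpose, smul_smul]

variable [DecidableEq ι]

lemma vecMSD_eq_dotProduct {x v : ι → ℝ} (hx : x - μ = B *ᵥ v) (S : Matrix ι ι ℝ) :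
    vecMSD x μ S = v ⬝ᵥ ((Bᵀ * S⁻¹ * B) *ᵥ v) := by
  rw [vecMSD, hx, ← Matrix.mulVec_mulVec, ← Matrix.mulVec_mulVec, Matrix.dotProduct_mulVec v,
    Matrix.vecMul_transpose]

lemma vecMSD_eq_norm_sq (hB : IsUnit B) {x : ι → ℝ} {z : EuclideanSpace ℝ ι}
    (hx : x = μ + B *ᵥ z) : vecMSD x μ (B * Bᵀ) = ‖z‖ ^ 2 := by
  have hBw := transpose_mul_inv_conj_mul hB 1
  rw [Matrix.mul_one, inv_one] at hBw
  rw [vecMSD_eq_dotProduct (sub_eq_of_eq_add' hx), hBw, Matrix.one_mulVec,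
    EuclideanSpace.real_norm_sq_eq]
  simp only [dotProduct, sq]

lemma posDef_vecCov (hB : IsUnit B) (hx : ∀ k, x k = μ + B *ᵥ z k) (hN : 1 < N)
    (hS : (sampleCov z).PosDef) : (vecCov x).PosDef := by
  have hscale : 0 < (1 - (N : ℝ)⁻¹)⁻¹ :=
    inv_pos.2 (sub_pos.2 (inv_lt_one_of_one_lt₀ (by exact_mod_cast hN)))
  rw [vecCov_eq hx (by lia)]
  exact ((Matrix.IsUnit.posDef_star_right_conjugate_iff hB).2 hS).smul hscale

lemma vecMSD_vecMean_vecCov (hB : IsUnit B) (hx : ∀ k, x k = μ + B *ᵥ z k) (k : Fin N)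
    (hN : 1 < N) (hS : (sampleCov z).PosDef) :
    vecMSD (x k) (vecMean x) (vecCov x) = (1 - (N : ℝ)⁻¹)
      * ((z k - sampleMean z).ofLp ⬝ᵥ ((sampleCov z)⁻¹ *ᵥ (z k - sampleMean z).ofLp)) := by
  have hs : (1 - (N : ℝ)⁻¹)⁻¹ ≠ 0 :=
    inv_ne_zero (sub_pos.2 (inv_lt_one_of_one_lt₀ (by exact_mod_cast hN))).ne'
  have hunit : IsUnit (B * sampleCov z * Bᵀ).det := (Matrix.isUnit_iff_isUnit_det _).1
    ((hB.mul hS.isUnit).mul ((Matrix.isUnit_transpose B).2 hB))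
  have := invertibleOfNonzero hs
  rw [vecMSD_eq_dotProduct (sub_vecMean_eq hx k), vecCov_eq hx (by lia), Matrix.inv_smul _ _ hunit,
    invOf_eq_inv, inv_inv, Matrix.mul_smul, Matrix.smul_mul, transpose_mul_inv_conj_mul hB,
    Matrix.smul_mulVec, dotProduct_smul, smul_eq_mul]

lemma IsDistanceStable.abs_vecMSD_sub_le {k : Fin N} {δ : ℝ}
    (h : IsDistanceStable (fun k ↦ asColumn (z k)) k δ) (hB : IsUnit B)
    (hx : ∀ k, x k = μ + B *ᵥ z k) (hN : 1 < N) :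
    |vecMSD (x k) (vecMean x) (vecCov x) - vecMSD (x k) μ (B * Bᵀ)| ≤ δ + ‖z k‖ ^ 2 / N := by
  have hdist := h.abs_dotProduct_sub_le
  rw [vecMSD_vecMean_vecCov hB hx k hN h.posDef_sampleCov, vecMSD_eq_norm_sq hB (hx k)]
  set v := (z k - sampleMean z).ofLp ⬝ᵥ ((sampleCov z)⁻¹ *ᵥ (z k - sampleMean z).ofLp)
  have hinv : (N : ℝ)⁻¹ ≤ 1 := Nat.cast_inv_le_one N
  have hinv' : 0 ≤ (N : ℝ)⁻¹ := by positivity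
  calc |(1 - (N : ℝ)⁻¹) * v - ‖z k‖ ^ 2|
      = |(1 - (N : ℝ)⁻¹) * (v - ‖z k‖ ^ 2) - ‖z k‖ ^ 2 / N| := by ring_nf
    _ ≤ |(1 - (N : ℝ)⁻¹) * (v - ‖z k‖ ^ 2)| + |‖z k‖ ^ 2 / N| := abs_sub _ _
    _ = (1 - (N : ℝ)⁻¹) * |v - ‖z k‖ ^ 2| + ‖z k‖ ^ 2 / N := by
      rw [abs_mul, abs_of_nonneg (sub_nonneg.2 hinv),
        abs_of_nonneg (by positivity : 0 ≤ ‖z k‖ ^ 2 / (N : ℝ))]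
    _ ≤ 1 * δ + ‖z k‖ ^ 2 / N := by gcongr; linarith
    _ = δ + ‖z k‖ ^ 2 / N := by rw [one_mul]

end VectorAffine

section VectorConcentration

variable (ι : Type*) [Fintype ι] [DecidableEq ι] [Nonempty ι]

theorem exists_forall_measure_not_isDistanceStable_asColumn_le {ε K : ℝ} (hε : 0 < ε)
    (hK : 0 < K) (hεK : 480 ≤ ε * K ^ 2) :
    ∃ N₀ : ℕ, ∀ N ≥ N₀, ∀ (Ω : Type*) [MeasurableSpace Ω] (P : Measure Ω) [IsProbabilityMeasure P]
      (z : Fin N → Ω → EuclideanSpace ℝ ι),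
      (∀ k, HasLaw (z k) (stdGaussian (EuclideanSpace ℝ ι)) P) → iIndepFun z P →
      ∀ k, P {ω | ¬ (IsDistanceStable (fun l ↦ asColumn (z l ω)) k
          (K * ((Fintype.card ι + 1) / √N)) ∧ ‖z k ω‖ ^ 2 ≤ Fintype.card ι * √N)}
        ≤ ENNReal.ofReal ε := by
  obtain ⟨N₁, hN₁⟩ := exists_forall_measure_not_isDistanceStable_le ι Unit (half_pos hε) hK
    (by linarith)
  obtain ⟨N₂, hN₂⟩ := exists_nat_ge ((2 / ε) ^ 2)
  refine ⟨max N₁ N₂, fun N hN Ω _ P _ z hz hind k ↦ ?_⟩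
  have hd : (0 : ℝ) < Fintype.card ι := by exact_mod_cast Fintype.card_pos
  have hN' : (0 : ℝ) < N := by exact_mod_cast k.pos
  have hcol : HasLaw asColumn (stdGaussian (EuclideanSpace ℝ (Unit × ι)))
      (stdGaussian (EuclideanSpace ℝ ι)) := ⟨by fun_prop, stdGaussian_map (asColumn (ι := ι))⟩
  have hstable := hN₁ N ((le_max_left _ _).trans hN) Ω P (fun k ω ↦ asColumn (z k ω))
    (fun k ↦ hcol.comp (hz k)) (hind.comp (fun _ ↦ asColumn) fun _ ↦ by fun_prop) k
  rw [Fintype.card_unit, Nat.cast_one] at hstable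
  have hnorm : P {ω | Fintype.card ι * √N < ‖z k ω‖ ^ 2} ≤ ENNReal.ofReal (ε / 2) := by
    refine (measure_lt_le_ofReal_integral_div (integrable_norm_sq_of_hasLaw (hz k))
      (fun _ ↦ by positivity) (by positivity)).trans (ENNReal.ofReal_le_ofReal ?_)
    have hsqrt : 2 / ε ≤ √N := Real.le_sqrt_of_sq_le
      (hN₂.trans (Nat.cast_le.2 ((le_max_right _ _).trans hN)))
    rw [integral_norm_sq_of_hasLaw (hz k), div_mul_cancel_left₀ hd.ne']
    exact (inv_anti₀ (by positivity) hsqrt).trans_eq (inv_div _ _)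
  calc _ ≤ _ := (measure_mono fun ω hω ↦ ?_).trans (measure_union_le _ _)
    _ ≤ ENNReal.ofReal (ε / 2) + ENNReal.ofReal (ε / 2) := add_le_add hstable hnorm
    _ = ENNReal.ofReal ε := by
      rw [← ENNReal.ofReal_add (by positivity) (by positivity), add_halves]
  simpa only [Set.mem_union, Set.mem_ofPred_eq, not_and_or, not_le] using hω

end VectorConcentration

section Sample

variable {c r N : ℕ} {M : Matrix (Fin c) (Fin r) ℝ} {L : Matrix (Fin c) (Fin c) ℝ}
  {R : Matrix (Fin r) (Fin r) ℝ} {X : Fin N → Matrix (Fin c) (Fin r) ℝ}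
  {z : Fin N → EuclideanSpace ℝ (Fin r × Fin c)} {k : Fin N} {K : ℝ}

lemma IsDistanceStable.posDef_vecCov_and_abs_vecMSD_sub_le
    (h : IsDistanceStable (fun l ↦ asColumn (z l)) k
      (K * ((Fintype.card (Fin r × Fin c) + 1) / √N)))
    (hz : ‖z k‖ ^ 2 ≤ Fintype.card (Fin r × Fin c) * √N) (hL : IsUnit L) (hR : IsUnit R)
    (hX : ∀ k, X k = M + L * unvec (z k) * Rᵀ) (hc : 0 < c) (hr : 0 < r) (hN : 1 < N)
    (hK : 0 ≤ K) :
    (vecCov fun l ↦ (X l).vec).PosDef ∧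
      |vecMSD (X k).vec (vecMean fun l ↦ (X l).vec) (vecCov fun l ↦ (X l).vec)
        - vecMSD (X k).vec M.vec ((R * Rᵀ) ⊗ₖ (L * Lᵀ))| ≤ (2 * K + 1) * ((c * r) / √N) := by
  have hB := Matrix.IsUnit.kronecker hR hL
  have hcov : (R * Rᵀ) ⊗ₖ (L * Lᵀ) = (R ⊗ₖ L) * (R ⊗ₖ L)ᵀ := by
    rw [← Matrix.kroneckerMap_transpose, Matrix.mul_kronecker_mul]
  have hvec : ∀ l, (X l).vec = M.vec + (R ⊗ₖ L) *ᵥ z l := fun l ↦ by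
    rw [hX, Matrix.vec_add, ← Matrix.kronecker_mulVec_vec]
    rfl
  have hd : (1 : ℝ) ≤ c * r := by exact_mod_cast Nat.mul_pos hc hr
  rw [Fintype.card_prod, Fintype.card_fin, Fintype.card_fin, Nat.cast_mul, mul_comm (r : ℝ)] at h hz
  refine ⟨posDef_vecCov hB hvec hN h.posDef_sampleCov, ?_⟩
  rw [hcov]
  calc _ ≤ K * ((c * r + 1) / √N) + ‖z k‖ ^ 2 / N := h.abs_vecMSD_sub_le hB hvec hN
    _ ≤ K * ((c * r + c * r) / √N) + c * r * √N / N := by gcongr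
    _ = (2 * K + 1) * ((c * r) / √N) := by
      rw [mul_div_assoc _ √(N : ℝ), Real.sqrt_div_self]
      ring

end Sample

end MatrixNormal

end

open MatrixNormal in
theorem proposition1_general (ε : ℝ) (hε : 0 < ε) :
    ∃ K : ℝ, 0 < K ∧ ∀ c r : ℕ, 0 < c → 0 < r → ∃ N₀ : ℕ, ∀ N : ℕ, N₀ ≤ N →
      ∀ (M : Matrix (Fin c) (Fin r) ℝ) (Sc : Matrix (Fin c) (Fin c) ℝ)
        (Sr : Matrix (Fin r) (Fin r) ℝ), Sc.PosDef → Sr.PosDef →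
      ∀ (Ω : Type*) [MeasurableSpace Ω] (P : Measure Ω) [IsProbabilityMeasure P]
        (X : Fin N → Ω → Matrix (Fin c) (Fin r) ℝ), IsSample P X M Sc Sr →
      ∀ n : Fin N,
        P {ω | ¬ ((vecCov fun m => (X m ω).vec).PosDef ∧
            |vecMSD (X n ω).vec (vecMean fun m => (X m ω).vec) (vecCov fun m => (X m ω).vec)
              - vecMSD (X n ω).vec M.vec (Sr ⊗ₖ Sc)|
            ≤ K * ((c : ℝ) * r / √(N : ℝ)))} ≤ ENNReal.ofReal ε ∧
        P {ω | ¬ ((∃ Sc' Sr', IsFlipFlopMLE (fun m => X m ω) Sc' Sr') ∧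
            ∀ Sc' Sr', IsFlipFlopMLE (fun m => X m ω) Sc' Sr' →
              |matMSD (X n ω) (matMean fun m => X m ω) Sc' Sr' - matMSD (X n ω) M Sc Sr|
              ≤ K * (((c : ℝ) + r) / 2 / √(N : ℝ)))} ≤ ENNReal.ofReal ε := by
  set K := √(480 / ε)
  have hK : 0 < K := by positivity
  have hεK : ε * K ^ 2 = 480 := by
    rw [Real.sq_sqrt (by positivity), mul_div_cancel₀ _ hε.ne']
  refine ⟨2 * K + 1, by positivity, fun c r hc hr ↦ ?_⟩
  have := Fin.pos_iff_nonempty.1 hc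
  have := Fin.pos_iff_nonempty.1 hr
  obtain ⟨N₁, h₁⟩ :=
    exists_forall_measure_not_isDistanceStable_asColumn_le (Fin r × Fin c) hε hK hεK.ge
  obtain ⟨N₂, h₂⟩ :=
    exists_forall_measure_not_isDistanceStable_le (Fin c) (Fin r) hε hK (by linarith)
  refine ⟨max (max N₁ N₂) 2, fun N hN M Sc Sr hSc hSr Ω _ P _ X hX n ↦ ?_⟩
  simp only [max_le_iff] at hN
  obtain ⟨⟨hN₁, hN₂⟩, hN₃⟩ := hN
  obtain ⟨L, R, z, hL, hR, rfl, rfl, hXz, hz, hind⟩ := hX.exists_whitening hSc hSr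
  refine ⟨(measure_mono fun ω ↦ mt fun h ↦ ?_).trans (h₁ N hN₁ Ω P z hz hind n),
    (measure_mono fun ω ↦ mt fun h ↦ ?_).trans (h₂ N hN₂ Ω P z hz hind n)⟩
  · exact h.1.posDef_vecCov_and_abs_vecMSD_sub_le h.2 hL hR (hXz · ω) hc hr hN₃ hK.le
  · obtain ⟨hex, hall⟩ := h.isFlipFlopMLE hL hR hc.ne' hr.ne' (hXz · ω)
    refine ⟨hex, fun Sc Sr hMLE ↦ (hall Sc Sr hMLE).trans ?_⟩
    rw [Fintype.card_fin, Fintype.card_fin]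
    calc K * ((c + r) / √N) = 2 * K * ((c + r) / 2 / √N) := by ring
      _ ≤ (2 * K + 1) * ((c + r) / 2 / √N) := by gcongr; linarith

/-- The two `O_p` bounds as `N → ∞`, with a constant `K` that depends on the tolerance `ε` only: not
on the dimension `c = r`, the parameters, the observation index or the probability space. The
threshold `N₀` depends on `ε` and `c` only. -/
theorem proposition1 (ε : ℝ) (hε : 0 < ε) :
    ∃ K : ℝ, 0 < K ∧ ∀ c : ℕ, 0 < c → ∃ N₀ : ℕ, ∀ N : ℕ, N₀ ≤ N →
      ∀ (M Sc Sr : Matrix (Fin c) (Fin c) ℝ), Sc.PosDef → Sr.PosDef →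
      ∀ (Ω : Type*) [MeasurableSpace Ω] (P : Measure Ω) [IsProbabilityMeasure P]
        (X : Fin N → Ω → Matrix (Fin c) (Fin c) ℝ), MatrixNormal.IsSample P X M Sc Sr →
      ∀ n : Fin N,
        -- vector-based distance at the sample mean and the sample covariance
        P {ω | ¬ ((MatrixNormal.vecCov fun m => (X m ω).vec).PosDef ∧
            |MatrixNormal.vecMSD (X n ω).vec (MatrixNormal.vecMean fun m => (X m ω).vec)
                (MatrixNormal.vecCov fun m => (X m ω).vec)
              - MatrixNormal.vecMSD (X n ω).vec M.vec (Sr ⊗ₖ Sc)|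
            ≤ K * ((c : ℝ) ^ 2 / √(N : ℝ)))} ≤ ENNReal.ofReal ε ∧
        -- matrix-based distance at the sample mean and the flip-flop estimates
        P {ω | ¬ ((∃ Sc' Sr', MatrixNormal.IsFlipFlopMLE (fun m => X m ω) Sc' Sr') ∧
            ∀ Sc' Sr', MatrixNormal.IsFlipFlopMLE (fun m => X m ω) Sc' Sr' →
              |MatrixNormal.matMSD (X n ω) (MatrixNormal.matMean fun m => X m ω) Sc' Sr'
                - MatrixNormal.matMSD (X n ω) M Sc Sr|
              ≤ K * ((c : ℝ) / √(N : ℝ)))} ≤ ENNReal.ofReal ε := by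
  obtain ⟨K, hK, h⟩ := proposition1_general ε hε
  exact ⟨K, hK, fun c hc ↦ by simpa only [add_self_div_two, ← sq] using h c c hc hc⟩
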